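/- **Setting.** Let $0<|q|<1$ (either sign), $\theta=\tanh^{-1}q$, and for real $k$ let $\mu=\mu(k)=\sqrt{k^2+2}$. Write $s=\operatorname{sech}(x+\operatorname{sgn}(x)\theta)$, $t_x=\tanh(x+\operatorname{sgn}(x)\theta)$. For $k\in\mathbb R\setminus\{0\}$ let $$\psi(x,k)=\begin{bmatrix}(t_x-ik)^2\\-s^2\end{bmatrix}e^{ik(x-\theta)}+A\begin{bmatrix}-s^2\\(t_x-\mu)^2\end{bmatrix}e^{\mu(x-\theta)}\qquad(x<0),$$ $$\psi(x,k)=B\begin{bmatrix}(t_x-ik)^2\\-s^2\end{bmatrix}e^{ik(x+\theta)}+C\begin{bmatrix}(t_x+ik)^2\\-s^2\end{bmatrix}e^{-ik(x+\theta)}+D\begin{bmatrix}-s^2\\(t_x+\mu)^2\end{bmatrix}e^{-\mu(x+\theta)}\qquad(x>0),$$ where the coefficients $A,B,C,D$ (functions of $k$ and $q$), which make $\psi$ continuous at $x=0$ with $\psi'(0-)-\psi'(0+)=2q\,\psi(0)$, are, with $P=1+q^2(-2+k^2+2q^2)+2q(k^2+q^2)\mu+(k^2+q^2)\mu^2$,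 $$A=-\frac{2e^{(-ik+\mu)\theta}q(ik+q)(q^2-1)}{P},\qquad D=-A,$$ $$B=\frac{e^{-2ik\theta}(k-iq)\,\bigl(i+k(q+\mu)-iq(2q+\mu)\bigr)\bigl(k(q+\mu)-i(1+q\mu)\bigr)}{kP},$$ $$C=-\frac{iq\,\bigl(-1+(2+k^2)q^2+2q(k^2+q^2)\mu+(k^2+q^2)\mu^2\bigr)}{kP}.$$ Define $a(x,k),b(x,k)$ by $$\begin{bmatrix}a(x,k)\\b(x,k)\end{bmatrix}=v_+(x,k)=\begin{cases}\dfrac{\psi(-x,-k)}{(1+ik)^2B(-k)},&k>0,\\[2mm]\dfrac{\psi(x,k)}{(1-ik)^2B(k)},&k<0,\end{cases}$$ let $a_{\rm ev}(x,k)=\tfrac12(a(x,k)+a(-x,k))$, $b_{\rm ev}(x,k)=\tfrac12(b(x,k)+b(-x,k))$, and for $w_0:\mathbb R\to\mathbb R$ put $$f(k)=\frac{2}{\sqrt{2\pi}}\int_0^\infty\bigl(\overline{a_{\rm ev}(x,k)}-\overline{b_{\rm ev}(x,k)}\bigr)w_0(x)\,dx,$$ $$w(0,t)=\sqrt{\frac2\pi}\int_0^\infty\bigl(a(0,k)e^{-\frac12it(1+k^2)}+b(0,k)e^{\frac12it(1+k^2)}\bigr)f(k)\,dk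 .$$ **Proposition.** There is $q_0\in(0,1)$ such that for every family of constants $(C_{kl})_{k,l\in\mathbb N}$ there is $K>0$ with the following property. Let $0<|q|<q_0$ and let $w_0$ be real valued, even and smooth on $(0,\infty)$, with $$\|x^k\partial_x^lw_0\|_{L^\infty((0,\infty))}\le C_{kl}|q|\qquad\text{for all }k,l\in\mathbb N .$$ Then $w_0$ is integrable, the integrals defining $f(k)$ for $k>0$ and $w(0,t)$ for $t\ge1$ converge absolutely, and for all $t\ge1$ $$\left|\,w(0,t)+\frac{1}{\sqrt{2\pi t}}\,e^{it/2+i\pi/4}\int_{\mathbb R}w_0(x)\,dx\,\right|\le K\left(\frac{|q|}{t^{3/2}}+q^2\right),$$ that is, $w(0,t)=-\sqrt{\tfrac{2}{\pi t}}\,e^{it/2+i\pi/4}\int_0^\infty w_0\,dx+O(q/t^{3/2})+O(q^2)$. -/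

import Mathlib

open MeasureTheory Set
open scoped ComplexConjugate ContDiff

noncomputable section

namespace DeltaNLS

/-- The hyperbolic secant. -/
def sech (x : ℝ) : ℝ := (Real.cosh x)⁻¹

/-- The shift `θ = tanh⁻¹ q`. -/
def theta (q : ℝ) : ℝ := Real.artanh q

/-- `μ(k) = (k² + 2)^{1/2} > 0`. -/
def mu (k : ℝ) : ℝ := √(k ^ 2 + 2)

/-- The common real denominator of the scattering coefficients. -/
def den (q k : ℝ) : ℝ :=
  1 + q ^ 2 * (-2 + k ^ 2 + 2 * q ^ 2) + 2 * q * (k ^ 2 + q ^ 2) * mu k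
    + (k ^ 2 + q ^ 2) * mu k ^ 2

/-- The scattering coefficient `A(k)`. -/
def coefA (q k : ℝ) : ℂ :=
  -(2 * Complex.exp ((-(Complex.I * k) + mu k) * theta q) * q * (Complex.I * k + q)
      * (-1 + q ^ 2)) / den q k

/-- The scattering coefficient `B(k)`, for `k ≠ 0`. -/
def coefB (q k : ℝ) : ℂ :=
  Complex.exp (-(2 * Complex.I * k * theta q)) * (k - Complex.I * q)
      * (Complex.I + k * (q + mu k) - Complex.I * q * (2 * q + mu k))
      * (k * (q + mu k) - Complex.I * (1 + q * mu k))
    / (k * den q k)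

/-- The scattering coefficient `C(k)`, for `k ≠ 0`. -/
def coefC (q k : ℝ) : ℂ :=
  -(Complex.I * q * (-1 + (2 + k ^ 2) * q ^ 2 + 2 * q * (k ^ 2 + q ^ 2) * mu k
      + (k ^ 2 + q ^ 2) * mu k ^ 2))
    / (k * den q k)

/-- The scattering coefficient `D(k)`. -/
def coefD (q k : ℝ) : ℂ :=
  2 * Complex.exp ((-(Complex.I * k) + mu k) * theta q) * q * (Complex.I * k + q)
      * (-1 + q ^ 2) / den q k

/-- The expression of the generalized eigenfunction `ψ(x, k)` on the half line `x < 0`, where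
`x + sgn(x) θ = x - θ`. -/
def psiLeft (q x k : ℝ) : Fin 2 → ℂ :=
  let t : ℂ := Real.tanh (x - theta q)
  let s : ℂ := sech (x - theta q)
  Complex.exp (Complex.I * k * (x - theta q)) • ![(t - Complex.I * k) ^ 2, -s ^ 2]
    + (coefA q k * Complex.exp (mu k * (x - theta q))) • ![-s ^ 2, (t - mu k) ^ 2]

/-- The expression of the generalized eigenfunction `ψ(x, k)` on the half line `x > 0`, where
`x + sgn(x) θ = x + θ`. -/
def psiRight (q x k : ℝ) : Fin 2 → ℂ :=
  let t : ℂ := Real.tanh (x + theta q)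
  let s : ℂ := sech (x + theta q)
  (coefB q k * Complex.exp (Complex.I * k * (x + theta q))) •
      ![(t - Complex.I * k) ^ 2, -s ^ 2]
    + (coefC q k * Complex.exp (-(Complex.I * k * (x + theta q)))) •
      ![(t + Complex.I * k) ^ 2, -s ^ 2]
    + (coefD q k * Complex.exp (-(mu k * (x + theta q)))) • ![-s ^ 2, (t + mu k) ^ 2]

/-- The generalized eigenfunction `ψ(x, k)`, `H_q ψ = (1 + k²) ψ`, for real `k ≠ 0`. The two
expressions agree at `x = 0`, see `psi_continuity`. -/
def psi (q x k : ℝ) : Fin 2 → ℂ :=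
  if x ≤ 0 then psiLeft q x k else psiRight q x k

theorem mu_sq (k : ℝ) : mu k ^ 2 = k ^ 2 + 2 := Real.sq_sqrt (by positivity)

theorem mu_pos (k : ℝ) : 0 < mu k := Real.sqrt_pos.2 (by positivity)

theorem den_pos {q : ℝ} (hq : |q| < 1) (k : ℝ) : 0 < den q k := by
  have h : den q k = (1 - q ^ 2) ^ 2 + (k ^ 2 + q ^ 2) * (mu k + q) ^ 2 := by
    unfold den; ring
  have h1 : 0 < 1 - q ^ 2 := by
    have := (sq_lt_one_iff_abs_lt_one q).2 hq
    linarith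
  rw [h]; positivity

theorem tanh_theta {q : ℝ} (hq : |q| < 1) : Real.tanh (theta q) = q :=
  Real.tanh_artanh (abs_lt.1 hq)

theorem sech_sq (x : ℝ) : sech x ^ 2 = 1 - Real.tanh x ^ 2 := by
  have := Real.cosh_pos x
  have h := Real.cosh_sq x
  rw [sech, Real.tanh_eq_sinh_div_cosh]
  field_simp
  linarith

theorem sech_neg (x : ℝ) : sech (-x) = sech x := by simp [sech]

theorem exp_aux1 (q k : ℝ) : Complex.exp (-(2 * Complex.I * k * theta q))
    = (Complex.exp (Complex.I * k * theta q))⁻¹ ^ 2 := by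
  rw [← Complex.exp_neg, ← Complex.exp_nat_mul]; congr 1; push_cast; ring

theorem exp_aux2 (q k : ℝ) : Complex.exp ((-(Complex.I * k) + mu k) * theta q)
    = Complex.exp (mu k * theta q) * (Complex.exp (Complex.I * k * theta q))⁻¹ := by
  rw [← Complex.exp_neg, ← Complex.exp_add]; congr 1; ring

theorem den_cast (q k : ℝ) : (den q k : ℂ) = 1 + q ^ 2 * (-2 + k ^ 2 + 2 * q ^ 2)
      + 2 * q * (k ^ 2 + q ^ 2) * mu k + (k ^ 2 + q ^ 2) * mu k ^ 2 := by
  simp [den]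

theorem hasDerivAt_tanh_shift (c x : ℝ) :
    HasDerivAt (fun y : ℝ => (Real.tanh (y + c) : ℂ)) (1 - (Real.tanh (x + c) : ℂ) ^ 2) x := by
  have h := Real.cosh_pos (x + c)
  have h1 : HasDerivAt Real.tanh (1 - Real.tanh (x + c) ^ 2) (x + c) := by
    have e : Real.tanh = fun y => Real.sinh y / Real.cosh y :=
      funext Real.tanh_eq_sinh_div_cosh
    rw [e]
    refine ((Real.hasDerivAt_sinh (x + c)).div (Real.hasDerivAt_cosh (x + c)) h.ne').congr_deriv ?_
    field_simp
  exact_mod_cast (h1.comp_add_const x c).ofReal_comp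

theorem hasDerivAt_exp_shift (z : ℂ) (c x : ℝ) :
    HasDerivAt (fun y : ℝ => Complex.exp (z * (y + c))) (z * Complex.exp (z * (x + c))) x := by
  have h : HasDerivAt (fun y : ℂ => Complex.exp (z * (y + c)))
      (z * Complex.exp (z * (x + c))) x := by
    refine (((hasDerivAt_id (x : ℂ)).add_const (c : ℂ)).const_mul z).cexp.congr_deriv ?_
    simp; ring
  exact h.comp_ofReal

theorem hasDerivAt_tanh_wave (z w : ℂ) (c : ℝ) :
    HasDerivAt (fun y : ℝ => Complex.exp (z * (y + c)) * ((Real.tanh (y + c) : ℂ) + w) ^ 2)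
      (Complex.exp (z * c) * (z * ((Real.tanh c : ℂ) + w) ^ 2
        + 2 * ((Real.tanh c : ℂ) + w) * (1 - (Real.tanh c : ℂ) ^ 2))) 0 := by
  refine ((hasDerivAt_exp_shift z c 0).mul
    (((hasDerivAt_tanh_shift c 0).add_const w).pow 2)).congr_deriv ?_
  simp; ring

theorem hasDerivAt_sech_wave (z : ℂ) (c : ℝ) :
    HasDerivAt (fun y : ℝ => Complex.exp (z * (y + c)) * -(sech (y + c) : ℂ) ^ 2)
      (Complex.exp (z * c) * (-z + 2 * (Real.tanh c : ℂ)) * (1 - (Real.tanh c : ℂ) ^ 2)) 0 := by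
  have e : (fun y : ℝ => Complex.exp (z * (y + c)) * -(sech (y + c) : ℂ) ^ 2) =
      fun y : ℝ => Complex.exp (z * (y + c)) * ((Real.tanh (y + c) : ℂ) ^ 2 - 1) := by
    funext y
    have h : (sech (y + c) : ℂ) ^ 2 = 1 - (Real.tanh (y + c) : ℂ) ^ 2 := by
      exact_mod_cast congrArg (fun z : ℝ => (z : ℂ)) (sech_sq (y + c))
    rw [h]; ring
  rw [e]
  refine ((hasDerivAt_exp_shift z c 0).mul
    (((hasDerivAt_tanh_shift c 0).pow 2).sub_const 1)).congr_deriv ?_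
  simp; ring

/-- The scattering coefficients are such that `ψ` is continuous at `0`. -/
theorem psi_continuity {q k : ℝ} (hq : |q| < 1) (hk : k ≠ 0) :
    psiLeft q 0 k = psiRight q 0 k := by
  have hd : (den q k : ℂ) ≠ 0 := by exact_mod_cast (den_pos hq k).ne'
  have hk' : (k : ℂ) ≠ 0 := by exact_mod_cast hk
  have hI := Complex.I_sq
  have hmu : (mu k : ℂ) ^ 2 = k ^ 2 + 2 := by exact_mod_cast mu_sq k
  have hs : (sech (theta q) : ℂ) ^ 2 = 1 - q ^ 2 := by
    have := sech_sq (theta q); rw [tanh_theta hq] at this; exact_mod_cast this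
  have hden := den_cast q k
  have e1 : Complex.exp (Complex.I * k * theta q) ≠ 0 := Complex.exp_ne_zero _
  have e2 : Complex.exp (mu k * theta q) ≠ 0 := Complex.exp_ne_zero _
  ext i
  fin_cases i <;>
  · simp only [psiLeft, psiRight, coefA, coefB, coefC, coefD, zero_sub, zero_add, sech_neg,
      Real.tanh_neg, tanh_theta hq, hs, mul_neg, Complex.ofReal_zero]
    rw [exp_aux1, exp_aux2]
    simp only [Complex.exp_neg]
    generalize Complex.exp (Complex.I * k * theta q) = E at *
    generalize Complex.exp (mu k * theta q) = F at *
    simp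
    field_simp
    rw [hden]
    clear hden hd e1 e2 hs hk' hk hq
    generalize (mu k : ℂ) = m at *
    generalize (k : ℂ) = k at *
    generalize (q : ℂ) = q at *
    grind

/-- The scattering coefficients are such that the derivative of `ψ` has at `0` the jump
`ψ'(0-) - ψ'(0+) = 2 q ψ(0)` that the potential `-2 q δ₀` of `H_q` prescribes. -/
theorem psi_jump {q k : ℝ} (hq : |q| < 1) (hk : k ≠ 0) (i : Fin 2) :
    ∃ l r : ℂ, HasDerivAt (fun x : ℝ => psiLeft q x k i) l 0 ∧
      HasDerivAt (fun x : ℝ => psiRight q x k i) r 0 ∧ l - r = 2 * q * psi q 0 k i := by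
  have hd : (den q k : ℂ) ≠ 0 := by exact_mod_cast (den_pos hq k).ne'
  have hk' : (k : ℂ) ≠ 0 := by exact_mod_cast hk
  have hI := Complex.I_sq
  have hmu : (mu k : ℂ) ^ 2 = k ^ 2 + 2 := by exact_mod_cast mu_sq k
  have hs : (sech (theta q) : ℂ) ^ 2 = 1 - q ^ 2 := by
    have := sech_sq (theta q); rw [tanh_theta hq] at this; exact_mod_cast this
  have hden := den_cast q k
  have e1 : Complex.exp (Complex.I * k * theta q) ≠ 0 := Complex.exp_ne_zero _
  have e2 : Complex.exp (mu k * theta q) ≠ 0 := Complex.exp_ne_zero _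
  fin_cases i
  · have L := (hasDerivAt_tanh_wave (Complex.I * k) (-(Complex.I * k)) (-theta q)).add
      ((hasDerivAt_sech_wave (mu k) (-theta q)).const_mul (coefA q k))
    have R := (((hasDerivAt_tanh_wave (Complex.I * k) (-(Complex.I * k)) (theta q)).const_mul
      (coefB q k)).add ((hasDerivAt_tanh_wave (-(Complex.I * k)) (Complex.I * k)
      (theta q)).const_mul (coefC q k))).add
      ((hasDerivAt_sech_wave (-mu k) (theta q)).const_mul (coefD q k))
    refine ⟨_, _, L.congr_of_eventuallyEq (.of_forall fun x => ?_),
      R.congr_of_eventuallyEq (.of_forall fun x => ?_), ?_⟩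
    · simp [psiLeft, sub_eq_add_neg]; ring
    · simp [psiRight, sub_eq_add_neg]; ring
    simp only [psi, le_refl, if_true, psiLeft, coefA, coefB, coefC, coefD, zero_sub, sech_neg,
      Complex.ofReal_neg, Real.tanh_neg, tanh_theta hq, hs, mul_neg, neg_mul,
      Complex.ofReal_zero]
    rw [exp_aux1, exp_aux2]
    simp only [Complex.exp_neg]
    generalize Complex.exp (Complex.I * k * theta q) = E at *
    generalize Complex.exp (mu k * theta q) = F at *
    simp
    field_simp
    rw [hden]
    clear L R hden hd e1 e2 hs hk' hk hq
    generalize (mu k : ℂ) = m at *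
    generalize (k : ℂ) = k at *
    generalize (q : ℂ) = q at *
    grind
  · have L := (hasDerivAt_sech_wave (Complex.I * k) (-theta q)).add
      ((hasDerivAt_tanh_wave (mu k) (-mu k) (-theta q)).const_mul (coefA q k))
    have R := (((hasDerivAt_sech_wave (Complex.I * k) (theta q)).const_mul
      (coefB q k)).add ((hasDerivAt_sech_wave (-(Complex.I * k))
      (theta q)).const_mul (coefC q k))).add
      ((hasDerivAt_tanh_wave (-mu k) (mu k) (theta q)).const_mul (coefD q k))
    refine ⟨_, _, L.congr_of_eventuallyEq (.of_forall fun x => ?_),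
      R.congr_of_eventuallyEq (.of_forall fun x => ?_), ?_⟩
    · simp [psiLeft, sub_eq_add_neg]; ring
    · simp [psiRight, sub_eq_add_neg]; ring
    simp only [psi, le_refl, if_true, psiLeft, coefA, coefB, coefC, coefD, zero_sub, sech_neg,
      Complex.ofReal_neg, Real.tanh_neg, tanh_theta hq, hs, mul_neg, neg_mul,
      Complex.ofReal_zero]
    rw [exp_aux1, exp_aux2]
    simp only [Complex.exp_neg]
    generalize Complex.exp (Complex.I * k * theta q) = E at *
    generalize Complex.exp (mu k * theta q) = F at *
    simp
    field_simp
    rw [hden]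
    clear L R hden hd e1 e2 hs hk' hk hq
    generalize (mu k : ℂ) = m at *
    generalize (k : ℂ) = k at *
    generalize (q : ℂ) = q at *
    grind

/-- The distorted plane waves `v₊(x, k)`, `k ≠ 0`: `a₊(k) ψ(-x, -k)` for `k > 0` and
`a₋(k) ψ(x, k)` for `k < 0`, where `a_±(k) = 1 / ((1 ± i k)² B(∓k))`. -/
def vPlus (q x k : ℝ) : Fin 2 → ℂ :=
  if 0 < k then (1 / ((1 + Complex.I * k) ^ 2 * coefB q (-k))) • psi q (-x) (-k)
  else (1 / ((1 - Complex.I * k) ^ 2 * coefB q k)) • psi q x k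

/-- The first component `a(x, k)` of `v₊(x, k)`. -/
def a (q x k : ℝ) : ℂ := vPlus q x k 0

/-- The second component `b(x, k)` of `v₊(x, k)`. -/
def b (q x k : ℝ) : ℂ := vPlus q x k 1

/-- The even part of `a` in `x`. -/
def aEven (q x k : ℝ) : ℂ := (a q x k + a q (-x) k) / 2

/-- The even part of `b` in `x`. -/
def bEven (q x k : ℝ) : ℂ := (b q x k + b q (-x) k) / 2

/-- The integrand, as a function of `x`, of the distorted Fourier transform `f(k)` of `w₀`. -/
def transformIntegrand (q : ℝ) (w₀ : ℝ → ℝ) (k x : ℝ) : ℂ :=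
  (conj (aEven q x k) - conj (bEven q x k)) * w₀ x

/-- The distorted Fourier transform `f(k)` of the even function `w₀`. -/
def transform (q : ℝ) (w₀ : ℝ → ℝ) (k : ℝ) : ℂ :=
  2 / √(2 * Real.pi) * ∫ x in Ioi (0 : ℝ), transformIntegrand q w₀ k x

/-- The integrand, as a function of `k`, in the formula for `w(0, t)`. -/
def waveIntegrand (q : ℝ) (w₀ : ℝ → ℝ) (t k : ℝ) : ℂ :=
  (a q 0 k * Complex.exp (-(1 / 2 * Complex.I * t * (1 + k ^ 2)))
    + b q 0 k * Complex.exp (1 / 2 * Complex.I * t * (1 + k ^ 2))) * transform q w₀ k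

/-- The value `w(0, t)` at `x = 0` of the continuous spectrum part of the linearized
propagator applied to `w₀`. -/
def wZero (q : ℝ) (w₀ : ℝ → ℝ) (t : ℝ) : ℂ :=
  √(2 / Real.pi) * ∫ k in Ioi (0 : ℝ), waveIntegrand q w₀ t k

/-- The assumptions on the perturbation `w₀` for the parameter `q` and the constants `C k l`:
`w₀` is real and even, smooth on `(0, ∞)`, and `‖x^k ∂^l w₀‖ ≤ C k l |q|` in `L^∞(0, ∞)`. -/
structure Admissible (C : ℕ → ℕ → ℝ) (q : ℝ) (w₀ : ℝ → ℝ) : Prop where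
  even : ∀ x, w₀ (-x) = w₀ x
  smooth : ContDiffOn ℝ ∞ w₀ (Ioi 0)
  bound : ∀ k l : ℕ, ∀ x : ℝ, 0 < x → |x ^ k * iteratedDeriv l w₀ x| ≤ C k l * |q|

end DeltaNLS

end

/-!
For real `k` the coefficients satisfy `D = -A` and
`(1 + C) (k - iq) = B exp (2ikθ) (k + iq)`, so the evanescent waves cancel in the even part of
`v₊(·, k)`, and what remains is a complex factor depending on `k` only times a real function of
`x`. In `w(0, t)` that factor enters through its squared modulus, and `w(0, t)` becomes a
combination of the two Fresnel integrals of `exp (∓itk²/2)` against `k²/(1 + k²)²` and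
`(1 - q²) k²/((k² + q²) (1 + k²)²)`, both times a real transform `Φ_q(k)` of `w₀`.

At `q = 0` the first multiplier vanishes at `k = 0` and contributes no `t^{-1/2}` term, while the
second becomes `1/(1 + k²)²`; since `Φ_0(0) = ∫₀^∞ w₀`, it produces the leading term. Both
multipliers are cosine transforms of exponentially decaying profiles, and integration by parts
rids `Φ_0` of its growing factor `k²` and turns it, up to an additive constant, into the cosine
transform of a fast decaying function. Hence the products are cosine transforms too, and replacing
`exp (-y²/(4b))` by `1` in their explicit Gaussian integrals costs `O(t^{-3/2})`. Passing from
`q = 0` to `q` costs `O(q)` in `L¹(dk)`: `Φ_q - Φ_0` is `O(q)` uniformly in `k`, and the second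
multiplier changes by at most the Lorentzian `q²/(k² + q²)`, whose integral over `k > 0` is
`π|q|/2`. As the data are themselves `O(q)`, every bound gains one more factor `q`.
-/

noncomputable section

namespace DeltaNLS

open Complex (I)
open Filter Topology

/-- The Gaussian integral `∫₀^∞ exp(-b k²) G(k) dk` of a function on the half line: a Fresnel
integral when `b` is purely imaginary. -/
def gaussianIntegral (G : ℝ → ℝ) (b : ℂ) : ℂ :=
  ∫ k in Ioi (0 : ℝ), Complex.exp (-b * k ^ 2) * G k

/-- The cosine transform `k ↦ ∫ P(y) cos(k z(y)) dμ(y)` with amplitude `P` and frequency `z` on an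
arbitrary measure space, so that iterated and shifted cosine integrals are covered as well. -/
def cosTransform {α : Type*} [MeasurableSpace α] (μ : Measure α) (P z : α → ℝ) (k : ℝ) : ℝ :=
  ∫ y, P y * Real.cos (k * z y) ∂μ

theorem norm_exp_sub_one_le_norm_of_re_nonpos {w : ℂ} (hw : w.re ≤ 0) :
    ‖Complex.exp w - 1‖ ≤ ‖w‖ := by
  simpa using (convex_halfSpace_re_le 0).norm_image_sub_le_of_norm_deriv_le (C := 1)
    (fun z _ => Complex.differentiableAt_exp)
    (fun z (hz : z.re ≤ 0) => by simpa [Complex.norm_exp] using hz)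
    (show (0 : ℂ).re ≤ 0 by simp) hw

theorem norm_cexp_neg_mul_sq_le_one {b : ℂ} (hb : 0 ≤ b.re) (x : ℝ) :
    ‖Complex.exp (-b * x ^ 2)‖ ≤ 1 := by
  rw [norm_cexp_neg_mul_sq, Real.exp_le_one_iff, neg_mul]
  exact neg_nonpos.2 (by positivity)

theorem norm_pi_div_cpow_half (b : ℂ) :
    ‖((Real.pi : ℂ) / b) ^ (1 / 2 : ℂ)‖ = √(Real.pi / ‖b‖) := by
  rw [show (1 / 2 : ℂ) = ((1 / 2 : ℝ) : ℂ) by push_cast; rfl, Complex.norm_cpow_real,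
    Real.sqrt_eq_rpow, norm_div, Complex.norm_real, Real.norm_of_nonneg Real.pi_pos.le]

theorem re_inv_four_mul_nonneg {b : ℂ} (hb : 0 ≤ b.re) : 0 ≤ ((4 * b)⁻¹).re := by
  rw [Complex.inv_re]
  exact div_nonneg (by simpa using hb) (Complex.normSq_nonneg _)

section CosTransform

variable {α : Type*} [MeasurableSpace α] {μ : Measure α} {P z : α → ℝ}

theorem continuousOn_integral_cexp_neg_mul_sq (hP : Integrable P μ)
    (hz : AEStronglyMeasurable z μ) :
    ContinuousOn (fun b : ℂ => ∫ y, Complex.exp (-b * z y ^ 2) * P y ∂μ) {b | 0 ≤ b.re} := by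
  refine continuousOn_of_dominated (bound := fun y => ‖P y‖) (fun b _ => ?_)
    (fun b hb => .of_forall fun y => ?_) hP.norm (.of_forall fun y => by fun_prop)
  · exact (Complex.continuous_exp.comp_aestronglyMeasurable
      (((Complex.continuous_ofReal.comp_aestronglyMeasurable hz).pow 2).const_mul (-b))).mul
      hP.ofReal.aestronglyMeasurable
  · rw [norm_mul, Complex.norm_real]
    exact mul_le_of_le_one_left (norm_nonneg _) (norm_cexp_neg_mul_sq_le_one hb _)

theorem integral_Ioi_gaussian_mul_cos {b : ℂ} (hb : 0 < b.re) (z : ℝ) :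
    ∫ k in Ioi (0 : ℝ), Complex.exp (-b * k ^ 2) * Real.cos (k * z)
      = (Real.pi / b) ^ (1 / 2 : ℂ) / 2 * Complex.exp (-(4 * b)⁻¹ * z ^ 2) := by
  set f : ℝ → ℂ := fun k => Complex.exp (I * z * k) * Complex.exp (-b * k ^ 2) with hf
  have hfi : Integrable f := by
    refine (integrable_cexp_neg_mul_sq hb).bdd_mul (c := 1) (by fun_prop) (.of_forall fun k => ?_)
    rw [Complex.norm_exp]; simp
  have hfold : ∫ k, f k = ∫ k in Ioi (0 : ℝ), (f (-k) + f k) := by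
    rw [integral_add hfi.comp_neg.integrableOn hfi.integrableOn, integral_comp_neg_Ioi, neg_zero,
      intervalIntegral.integral_Iic_add_Ioi hfi.integrableOn hfi.integrableOn]
  have heven : ∀ k : ℝ,
      f (-k) + f k = 2 * (Complex.exp (-b * k ^ 2) * Real.cos (k * z)) := by
    intro k
    simp only [hf, Complex.ofReal_cos, Complex.cos, Complex.ofReal_neg, Complex.ofReal_mul]
    ring_nf
  have hfourier := fourierIntegral_gaussian hb (z : ℂ)
  rw [hfold] at hfourier
  simp only [heven, integral_const_mul] at hfourier
  rw [show -(4 * b)⁻¹ * (z : ℂ) ^ 2 = -z ^ 2 / (4 * b) by ring]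
  linear_combination hfourier / 2

theorem gaussianIntegral_cosTransform_of_re_pos [SFinite μ] (hP : Integrable P μ)
    (hz : AEStronglyMeasurable z μ) {b : ℂ} (hb : 0 < b.re) :
    gaussianIntegral (cosTransform μ P z) b
      = (Real.pi / b) ^ (1 / 2 : ℂ) / 2 * ∫ y, Complex.exp (-(4 * b)⁻¹ * z y ^ 2) * P y ∂μ := by
  have hint : Integrable (fun p : ℝ × α => Complex.exp (-b * p.1 ^ 2) * (P p.2 : ℂ)
      * Real.cos (p.1 * z p.2)) ((volume.restrict (Ioi 0)).prod μ) := by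
    refine (((integrable_cexp_neg_mul_sq hb).integrableOn).mul_prod hP.ofReal).mul_bdd (c := 1)
      ?_ (.of_forall fun p => ?_)
    · exact Complex.continuous_ofReal.comp_aestronglyMeasurable
        (Real.continuous_cos.comp_aestronglyMeasurable
          (measurable_fst.aestronglyMeasurable.mul hz.comp_snd))
    · rw [Complex.norm_real]
      exact Real.abs_cos_le_one _
  calc gaussianIntegral (cosTransform μ P z) b
      = ∫ k in Ioi (0 : ℝ), ∫ y,
          Complex.exp (-b * k ^ 2) * (P y : ℂ) * Real.cos (k * z y) ∂μ := by
        simp only [gaussianIntegral, cosTransform, ← integral_complex_ofReal, ← integral_const_mul,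
          Complex.ofReal_mul, mul_assoc]
    _ = ∫ y, (∫ k in Ioi (0 : ℝ),
          Complex.exp (-b * k ^ 2) * (P y : ℂ) * Real.cos (k * z y)) ∂μ :=
        integral_integral_swap hint
    _ = ∫ y, (Real.pi / b) ^ (1 / 2 : ℂ) / 2
          * (Complex.exp (-(4 * b)⁻¹ * z y ^ 2) * P y) ∂μ := by
        simp only [mul_right_comm _ (P _ : ℂ), integral_mul_const,
          integral_Ioi_gaussian_mul_cos hb]
        simp only [mul_assoc]
    _ = _ := integral_const_mul _ _

/- Both sides are continuous in `b` on the closed half plane without the origin, so the identity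
persists on the imaginary axis, where the Gaussian integral is only conditionally convergent. -/
theorem gaussianIntegral_cosTransform [SFinite μ] (hP : Integrable P μ)
    (hz : AEStronglyMeasurable z μ) (hG : IntegrableOn (cosTransform μ P z) (Ioi 0)) {b : ℂ}
    (hb : 0 ≤ b.re) (hb0 : b ≠ 0) :
    gaussianIntegral (cosTransform μ P z) b
      = (Real.pi / b) ^ (1 / 2 : ℂ) / 2 * ∫ y, Complex.exp (-(4 * b)⁻¹ * z y ^ 2) * P y ∂μ := by
  set S : Set ℂ := {b | 0 ≤ b.re} \ {0}
  have hleft : ContinuousOn (gaussianIntegral (cosTransform μ P z)) S :=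
    (continuousOn_integral_cexp_neg_mul_sq hG
      continuous_id.aestronglyMeasurable).mono sdiff_subset
  have hroot : ContinuousOn (fun b : ℂ => ((Real.pi : ℂ) / b) ^ (1 / 2 : ℂ) / 2) S := by
    refine ((continuousOn_const.div continuousOn_id fun b hb => hb.2).cpow continuousOn_const
      fun b hb => ?_).div_const 2
    have hpos : 0 < Complex.normSq b := Complex.normSq_pos.2 hb.2
    rcases (show 0 ≤ b.re from hb.1).eq_or_lt with hre | hre
    · refine Or.inr fun him => hb.2 (Complex.ext hre.symm ?_)
      simpa [Complex.div_im, Real.pi_ne_zero, hpos.ne'] using him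
    · refine Or.inl (?_ : 0 < ((Real.pi : ℂ) / b).re)
      simp only [Complex.div_re, Complex.ofReal_re, Complex.ofReal_im, zero_mul, zero_div,
        add_zero]
      positivity
  have hright : ContinuousOn
      (fun b : ℂ => ∫ y, Complex.exp (-(4 * b)⁻¹ * z y ^ 2) * P y ∂μ) S :=
    (continuousOn_integral_cexp_neg_mul_sq hP hz).comp
      ((continuousOn_const.mul continuousOn_id).inv₀ fun b hb => by simpa using hb.2)
      fun b hb => re_inv_four_mul_nonneg hb.1
  have hopen : EqOn (gaussianIntegral (cosTransform μ P z)) _ {b | 0 < b.re} := fun b hb =>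
    gaussianIntegral_cosTransform_of_re_pos hP hz hb
  refine hopen.of_subset_closure hleft (hroot.mul hright)
    (fun b (hb : 0 < b.re) => ⟨hb.le, fun h0 => by simp_all⟩) ?_ ⟨hb, hb0⟩
  rw [Complex.closure_setOfPred_lt_re]
  exact sdiff_subset

end CosTransform

/-- `G` obeys the stationary phase formula with leading coefficient `a` (the value `G 0` in the
smooth case): its Gaussian integrals `∫₀^∞ exp(-b k²) G(k) dk` equal `(π / b)^{1/2} a / 2` up to
`E |b|^{-3/2} + ε`. All `b ≠ 0` in the closed right half plane are included; the Fresnel integrals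
are the case of imaginary `b`. -/
structure HasStationaryPhase (G : ℝ → ℝ) (a E ε : ℝ) : Prop where
  integrableOn : IntegrableOn G (Ioi 0)
  norm_sub_le : ∀ b : ℂ, 0 ≤ b.re → b ≠ 0 →
    ‖gaussianIntegral G b - (Real.pi / b) ^ (1 / 2 : ℂ) / 2 * a‖ ≤ E / ‖b‖ ^ (3 / 2 : ℝ) + ε

theorem integrableOn_cexp_neg_mul_sq_mul {G : ℝ → ℝ} (hG : IntegrableOn G (Ioi 0)) {b : ℂ}
    (hb : 0 ≤ b.re) :
    IntegrableOn (fun k : ℝ => Complex.exp (-b * k ^ 2) * (G k : ℂ)) (Ioi 0) :=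
  hG.ofReal.bdd_mul (c := 1) (by fun_prop) (.of_forall (norm_cexp_neg_mul_sq_le_one hb))

namespace HasStationaryPhase

variable {G G' H g : ℝ → ℝ} {a a' E E' ε ε' : ℝ}

theorem mono (h : HasStationaryPhase G a E ε) (hE : E ≤ E') (hε : ε ≤ ε') :
    HasStationaryPhase G a E' ε' where
  integrableOn := h.integrableOn
  norm_sub_le b hb hb0 := (h.norm_sub_le b hb hb0).trans (by gcongr)

theorem add (h : HasStationaryPhase G a E ε) (h' : HasStationaryPhase G' a' E' ε') :
    HasStationaryPhase (fun k => G k + G' k) (a + a') (E + E') (ε + ε') where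
  integrableOn := h.integrableOn.add h'.integrableOn
  norm_sub_le b hb hb0 := by
    have hsplit : gaussianIntegral (fun k => G k + G' k) b
        = gaussianIntegral G b + gaussianIntegral G' b := by
      simp only [gaussianIntegral, Complex.ofReal_add, mul_add]
      exact integral_add (integrableOn_cexp_neg_mul_sq_mul h.integrableOn hb)
        (integrableOn_cexp_neg_mul_sq_mul h'.integrableOn hb)
    calc ‖gaussianIntegral (fun k => G k + G' k) b
          - (Real.pi / b) ^ (1 / 2 : ℂ) / 2 * (a + a' : ℝ)‖
        = ‖(gaussianIntegral G b - (Real.pi / b) ^ (1 / 2 : ℂ) / 2 * a)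
          + (gaussianIntegral G' b - (Real.pi / b) ^ (1 / 2 : ℂ) / 2 * a')‖ := by
          rw [hsplit]; push_cast; ring_nf
      _ ≤ (E / ‖b‖ ^ (3 / 2 : ℝ) + ε) + (E' / ‖b‖ ^ (3 / 2 : ℝ) + ε') :=
          norm_add_le_of_le (h.norm_sub_le b hb hb0) (h'.norm_sub_le b hb hb0)
      _ = (E + E') / ‖b‖ ^ (3 / 2 : ℝ) + (ε + ε') := by ring

theorem perturb (h : HasStationaryPhase G a E ε)
    (hH : AEStronglyMeasurable H (volume.restrict (Ioi 0))) (hg : IntegrableOn g (Ioi 0))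
    (hHG : ∀ k, 0 < k → |H k - G k| ≤ g k) :
    HasStationaryPhase H a E (ε + ∫ k in Ioi 0, g k) := by
  have hHG' : ∀ᵐ k ∂volume.restrict (Ioi 0), |H k - G k| ≤ g k :=
    (ae_restrict_mem measurableSet_Ioi).mono hHG
  have hdiff : IntegrableOn (fun k => H k - G k) (Ioi 0) :=
    hg.mono' (hH.sub h.integrableOn.aestronglyMeasurable) hHG'
  have hHint : IntegrableOn H (Ioi 0) :=
    (hdiff.add h.integrableOn).congr (.of_forall fun k => sub_add_cancel (H k) (G k))
  refine ⟨hHint, fun b hb hb0 => ?_⟩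
  have hclose : ‖gaussianIntegral H b - gaussianIntegral G b‖ ≤ ∫ k in Ioi 0, g k := by
    rw [gaussianIntegral, gaussianIntegral,
      ← integral_sub (integrableOn_cexp_neg_mul_sq_mul hHint hb)
        (integrableOn_cexp_neg_mul_sq_mul h.integrableOn hb)]
    refine norm_integral_le_of_norm_le hg (hHG'.mono fun k hk => ?_)
    rw [← mul_sub, ← Complex.ofReal_sub, norm_mul, Complex.norm_real]
    exact (mul_le_of_le_one_left (norm_nonneg _) (norm_cexp_neg_mul_sq_le_one hb k)).trans hk
  calc ‖gaussianIntegral H b - (Real.pi / b) ^ (1 / 2 : ℂ) / 2 * a‖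
      ≤ ‖gaussianIntegral H b - gaussianIntegral G b‖
        + ‖gaussianIntegral G b - (Real.pi / b) ^ (1 / 2 : ℂ) / 2 * a‖ :=
        norm_sub_le_norm_sub_add_norm_sub _ _ _
    _ ≤ E / ‖b‖ ^ (3 / 2 : ℝ) + (ε + ∫ k in Ioi 0, g k) := by
        linarith [h.norm_sub_le b hb hb0]

end HasStationaryPhase

section CosTransform

variable {α β : Type*} [MeasurableSpace α] [MeasurableSpace β] {μ : Measure α} {ν : Measure β}
  {P y : α → ℝ} {Q z : β → ℝ}

theorem integrable_of_integrable_one_add_sq_mul (hy : AEStronglyMeasurable y μ)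
    (hP : Integrable (fun x => (1 + y x ^ 2) * P x) μ) : Integrable P μ := by
  have hw : ∀ x, (1 + y x ^ 2) ≠ 0 := fun x => by positivity
  have h := hP.bdd_mul (c := 1) (f := fun x => (1 + y x ^ 2)⁻¹)
    (by fun_prop (disch := exact hw)) (.of_forall fun x => ?_)
  · simpa [hw] using h
  · rw [Real.norm_of_nonneg (by positivity)]
    exact inv_le_one_of_one_le₀ (by nlinarith [sq_nonneg (y x)])

theorem integrable_mul_comp_of_abs_le_one (hy : AEStronglyMeasurable y μ) (hP : Integrable P μ)
    {f : ℝ → ℝ} (hf : Continuous f) (hf1 : ∀ s, |f s| ≤ 1) (k : ℝ) :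
    Integrable (fun x => P x * f (k * y x)) μ :=
  hP.mul_bdd (c := 1) (hf.comp_aestronglyMeasurable (hy.const_mul k)) (.of_forall fun _ => hf1 _)

theorem continuous_cosTransform (hy : AEStronglyMeasurable y μ) (hP : Integrable P μ) :
    Continuous (cosTransform μ P y) := by
  refine continuous_of_dominated (bound := fun x => ‖P x‖)
    (fun k => (integrable_mul_comp_of_abs_le_one hy hP Real.continuous_cos Real.abs_cos_le_one
      k).aestronglyMeasurable)
    (fun k => .of_forall fun x => ?_) hP.norm (.of_forall fun x => by fun_prop)
  · rw [norm_mul]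
    exact mul_le_of_le_one_right (norm_nonneg _) (Real.abs_cos_le_one _)

theorem norm_cosTransform_le (hP : Integrable P μ) (k : ℝ) :
    ‖cosTransform μ P y k‖ ≤ ∫ x, ‖P x‖ ∂μ := by
  refine norm_integral_le_of_norm_le hP.norm (.of_forall fun x => ?_)
  rw [norm_mul]
  exact mul_le_of_le_one_right (norm_nonneg _) (Real.abs_cos_le_one _)

theorem norm_integral_cexp_sub_one_mul_le {c : ℂ} (hc : 0 ≤ c.re)
    (hPy : Integrable (fun x => y x ^ 2 * |P x|) μ) :
    ‖∫ x, (Complex.exp (-c * y x ^ 2) - 1) * (P x : ℂ) ∂μ‖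
      ≤ ‖c‖ * ∫ x, y x ^ 2 * |P x| ∂μ := by
  rw [← integral_const_mul]
  refine norm_integral_le_of_norm_le (hPy.const_mul _) (.of_forall fun x => ?_)
  have hre : (-c * (y x : ℂ) ^ 2).re ≤ 0 := by
    rw [neg_mul, Complex.neg_re, ← Complex.ofReal_pow, Complex.re_mul_ofReal]
    exact neg_nonpos.2 (mul_nonneg hc (sq_nonneg _))
  calc ‖(Complex.exp (-c * y x ^ 2) - 1) * (P x : ℂ)‖
      ≤ ‖-c * (y x : ℂ) ^ 2‖ * |P x| := by
        rw [norm_mul, Complex.norm_real, Real.norm_eq_abs]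
        exact mul_le_mul_of_nonneg_right (norm_exp_sub_one_le_norm_of_re_nonpos hre)
          (abs_nonneg _)
    _ = ‖c‖ * (y x ^ 2 * |P x|) := by simp [mul_assoc]

theorem hasStationaryPhase_cosTransform [SFinite μ] (hy : AEStronglyMeasurable y μ)
    (hP : Integrable P μ) (hPy : Integrable (fun x => y x ^ 2 * |P x|) μ)
    (hG : IntegrableOn (cosTransform μ P y) (Ioi 0)) :
    HasStationaryPhase (cosTransform μ P y) (∫ x, P x ∂μ) (1 / 4 * ∫ x, y x ^ 2 * |P x| ∂μ) 0 := by
  refine ⟨hG, fun b hb hb0 => ?_⟩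
  have hb' : 0 < ‖b‖ := norm_pos_iff.2 hb0
  have hPc : Integrable (fun x => (P x : ℂ)) μ := hP.ofReal
  have hexp : Integrable (fun x => Complex.exp (-(4 * b)⁻¹ * y x ^ 2) * (P x : ℂ)) μ := by
    refine hPc.bdd_mul (c := 1) (Complex.continuous_exp.comp_aestronglyMeasurable
      (((Complex.continuous_ofReal.comp_aestronglyMeasurable hy).pow 2).const_mul _))
      (.of_forall fun x => norm_cexp_neg_mul_sq_le_one (re_inv_four_mul_nonneg hb) _)
  have hsqrt : √(Real.pi / ‖b‖) ≤ 2 / √‖b‖ := by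
    rw [Real.sqrt_div Real.pi_pos.le]
    gcongr
    rw [Real.sqrt_le_left two_pos.le]
    linarith [Real.pi_le_four]
  have hpow : ‖b‖ ^ (3 / 2 : ℝ) = ‖b‖ * √‖b‖ := by
    rw [show (3 / 2 : ℝ) = 1 + 1 / 2 by norm_num, Real.rpow_add hb', Real.rpow_one,
      Real.sqrt_eq_rpow]
  calc ‖gaussianIntegral (cosTransform μ P y) b
        - (Real.pi / b) ^ (1 / 2 : ℂ) / 2 * (∫ x, P x ∂μ : ℝ)‖
      = √(Real.pi / ‖b‖) / 2
        * ‖∫ x, (Complex.exp (-(4 * b)⁻¹ * y x ^ 2) - 1) * (P x : ℂ) ∂μ‖ := by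
        rw [gaussianIntegral_cosTransform hP hy hG hb hb0, ← integral_complex_ofReal, ← mul_sub,
          ← integral_sub hexp hPc, norm_mul, norm_div, norm_pi_div_cpow_half,
          Complex.norm_ofNat]
        simp only [sub_mul, one_mul]
    _ ≤ 2 / √‖b‖ / 2 * (‖(4 * b)⁻¹‖ * ∫ x, y x ^ 2 * |P x| ∂μ) := by
        gcongr
        exact norm_integral_cexp_sub_one_mul_le (re_inv_four_mul_nonneg hb) hPy
    _ = (1 / 4 * ∫ x, y x ^ 2 * |P x| ∂μ) / ‖b‖ ^ (3 / 2 : ℝ) + 0 := by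
        rw [hpow, norm_inv, norm_mul, Complex.norm_ofNat]; field_simp; ring

theorem cosTransform_mul_cosTransform [SFinite μ] [SFinite ν] (hy : AEStronglyMeasurable y μ)
    (hP : Integrable P μ) (hz : AEStronglyMeasurable z ν) (hQ : Integrable Q ν) {k : ℝ}
    (hsin : ∫ x, P x * Real.sin (k * y x) ∂μ = 0) :
    cosTransform μ P y k * cosTransform ν Q z k
      = cosTransform (μ.prod ν) (fun p => P p.1 * Q p.2) (fun p => y p.1 + z p.2) k := by
  have hcos :=
    (integrable_mul_comp_of_abs_le_one hy hP Real.continuous_cos Real.abs_cos_le_one k).mul_prod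
      (integrable_mul_comp_of_abs_le_one hz hQ Real.continuous_cos Real.abs_cos_le_one k)
  have hsin' :=
    (integrable_mul_comp_of_abs_le_one hy hP Real.continuous_sin Real.abs_sin_le_one k).mul_prod
      (integrable_mul_comp_of_abs_le_one hz hQ Real.continuous_sin Real.abs_sin_le_one k)
  have hadd : ∀ p : α × β, P p.1 * Q p.2 * Real.cos (k * (y p.1 + z p.2))
      = (P p.1 * Real.cos (k * y p.1)) * (Q p.2 * Real.cos (k * z p.2))
        - (P p.1 * Real.sin (k * y p.1)) * (Q p.2 * Real.sin (k * z p.2)) := fun p => by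
    rw [mul_add, Real.cos_add]; ring
  simp only [cosTransform, hadd]
  rw [integral_sub hcos hsin',
    integral_prod_mul (fun x => P x * Real.cos (k * y x)) (fun x => Q x * Real.cos (k * z x)),
    integral_prod_mul (fun x => P x * Real.sin (k * y x)) (fun x => Q x * Real.sin (k * z x)),
    hsin, zero_mul, sub_zero]

theorem hasStationaryPhase_cosTransform_mul [SFinite μ] [SFinite ν]
    (hy : AEStronglyMeasurable y μ) (hP : Integrable (fun x => (1 + y x ^ 2) * P x) μ)
    (hz : AEStronglyMeasurable z ν) (hQ : Integrable (fun x => (1 + z x ^ 2) * Q x) ν)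
    (hsin : ∀ k, ∫ x, P x * Real.sin (k * y x) ∂μ = 0)
    (hG : IntegrableOn (cosTransform μ P y) (Ioi 0)) :
    HasStationaryPhase (fun k => cosTransform μ P y k * cosTransform ν Q z k)
      ((∫ x, P x ∂μ) * ∫ x, Q x ∂ν)
      (1 / 4 * ((∫ x, |(1 + y x ^ 2) * P x| ∂μ) * ∫ x, |(1 + z x ^ 2) * Q x| ∂ν)) 0 := by
  have hP' := integrable_of_integrable_one_add_sq_mul hy hP
  have hQ' := integrable_of_integrable_one_add_sq_mul hz hQ
  have hyz : AEStronglyMeasurable (fun p : α × β => y p.1 + z p.2) (μ.prod ν) :=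
    hy.comp_fst.add hz.comp_snd
  have hPQ : Integrable (fun p : α × β => P p.1 * Q p.2) (μ.prod ν) := hP'.mul_prod hQ'
  have hweight : Integrable (fun p : α × β => |(1 + y p.1 ^ 2) * P p.1|
      * |(1 + z p.2 ^ 2) * Q p.2|) (μ.prod ν) := hP.abs.mul_prod hQ.abs
  have hcauchy : ∀ p : α × β, (y p.1 + z p.2) ^ 2 * |P p.1 * Q p.2|
      ≤ |(1 + y p.1 ^ 2) * P p.1| * |(1 + z p.2 ^ 2) * Q p.2| := fun p => by
    have : (y p.1 + z p.2) ^ 2 ≤ (1 + y p.1 ^ 2) * (1 + z p.2 ^ 2) := by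
      nlinarith [sq_nonneg (y p.1 * z p.2 - 1)]
    rw [abs_mul, abs_mul, abs_mul, abs_of_nonneg (by positivity : 0 ≤ 1 + y p.1 ^ 2),
      abs_of_nonneg (by positivity : 0 ≤ 1 + z p.2 ^ 2), mul_mul_mul_comm]
    gcongr
  have hmoment : Integrable (fun p : α × β => (y p.1 + z p.2) ^ 2 * |P p.1 * Q p.2|)
      (μ.prod ν) :=
    hweight.mono' ((hyz.pow 2).mul hPQ.abs.aestronglyMeasurable) (.of_forall fun p => by
      rw [Real.norm_of_nonneg (by positivity)]; exact hcauchy p)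
  have hprod : (fun k => cosTransform μ P y k * cosTransform ν Q z k)
      = cosTransform (μ.prod ν) (fun p => P p.1 * Q p.2) (fun p => y p.1 + z p.2) :=
    funext fun k => cosTransform_mul_cosTransform hy hP' hz hQ' (hsin k)
  have hGH := hG.mul_bdd (c := ∫ x, ‖Q x‖ ∂ν)
    (continuous_cosTransform hz hQ').aestronglyMeasurable
    (.of_forall fun k => norm_cosTransform_le hQ' k)
  rw [hprod, ← integral_prod_mul, ← integral_prod_mul]
  refine (hasStationaryPhase_cosTransform hyz hPQ hmoment (hprod ▸ hGH)).mono ?_ le_rfl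
  exact mul_le_mul_of_nonneg_left (integral_mono hmoment hweight hcauchy) (by norm_num)

end CosTransform

theorem integrableOn_pow_mul_exp_neg_mul (n : ℕ) {r : ℝ} (hr : 0 < r) :
    IntegrableOn (fun y : ℝ => y ^ n * Real.exp (-(r * y))) (Ioi 0) := by
  simpa [neg_mul] using integrableOn_rpow_mul_exp_neg_mul_rpow (s := n) (p := 1)
    (neg_one_lt_zero.trans_le n.cast_nonneg) one_pos hr

theorem integrableOn_pow_mul_cexp_neg_mul (n : ℕ) {z : ℂ} (hz : 0 < z.re) :
    IntegrableOn (fun y : ℝ => (y : ℂ) ^ n * Complex.exp (-(z * y))) (Ioi 0) := by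
  refine (integrableOn_pow_mul_exp_neg_mul n hz).mono' (by fun_prop) ?_
  filter_upwards [ae_restrict_mem measurableSet_Ioi] with y (hy : 0 < y)
  simp [Complex.norm_exp, abs_of_pos hy]

theorem integral_Ioi_pow_mul_cexp_neg_mul (n : ℕ) {z : ℂ} (hz : 0 < z.re) :
    ∫ y in Ioi (0 : ℝ), (y : ℂ) ^ n * Complex.exp (-(z * y)) = n.factorial / z ^ (n + 1) := by
  have hz0 : z ≠ 0 := by rintro rfl; simp at hz
  induction n with
  | zero =>
    have h := integral_exp_mul_complex_Ioi (a := -z) (by simpa using hz) 0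
    simpa [neg_mul, neg_div_neg_eq] using h
  | succ n ih =>
    have hderiv : ∀ y ∈ Ioi (0 : ℝ), HasDerivAt
        (fun y : ℝ => (y : ℂ) ^ (n + 1) * Complex.exp (-(z * y)))
        ((n + 1) * (y ^ n * Complex.exp (-(z * y)))
          - z * (y ^ (n + 1) * Complex.exp (-(z * y)))) y := fun y _ => by
      have hid := (hasDerivAt_id (y : ℂ)).comp_ofReal
      refine ((hid.pow (n + 1)).mul ((hid.const_mul z).neg.cexp)).congr_deriv ?_
      simp only [Nat.cast_add, Nat.cast_one, id_eq, add_tsub_cancel_right, mul_one, Pi.neg_apply,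
        Pi.pow_apply, mul_neg]
      ring
    have hint := integrableOn_pow_mul_cexp_neg_mul n hz
    have hint' := integrableOn_pow_mul_cexp_neg_mul (n + 1) hz
    have hparts := integral_Ioi_of_hasDerivAt_of_tendsto
      (by fun_prop : ContinuousWithinAt
        (fun y : ℝ => (y : ℂ) ^ (n + 1) * Complex.exp (-(z * y))) (Ici 0) 0)
      hderiv ((hint.const_mul _).sub (hint'.const_mul _))
      (tendsto_zero_of_hasDerivAt_of_integrableOn_Ioi hderiv
        ((hint.const_mul _).sub (hint'.const_mul _)) hint')
    rw [integral_sub (hint.const_mul _) (hint'.const_mul _), integral_const_mul,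
      integral_const_mul, ih] at hparts
    have hrec : z * ∫ y in Ioi (0 : ℝ), (y : ℂ) ^ (n + 1) * Complex.exp (-(z * y))
        = (n + 1) * (n.factorial / z ^ (n + 1)) := by
      simp only [Complex.ofReal_zero, zero_pow n.succ_ne_zero, zero_mul, sub_zero] at hparts
      exact (sub_eq_zero.1 hparts).symm
    rw [eq_div_iff (pow_ne_zero _ hz0), pow_succ', ← mul_assoc, mul_comm _ z, hrec,
      Nat.factorial_succ]
    push_cast
    field_simp

theorem integrableOn_pow_mul_exp_neg (n : ℕ) :
    IntegrableOn (fun y : ℝ => y ^ n * Real.exp (-y)) (Ioi 0) := by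
  simpa using integrableOn_pow_mul_exp_neg_mul n one_pos

theorem integral_Ioi_pow_mul_exp_neg (n : ℕ) :
    ∫ y in Ioi (0 : ℝ), y ^ n * Real.exp (-y) = n.factorial := by
  rw [← Real.Gamma_nat_eq_factorial, Real.Gamma_eq_integral n.cast_add_one_pos]
  simp only [add_sub_cancel_right, Real.rpow_natCast, mul_comm]

theorem integral_Ioi_pow_mul_exp_neg_mul_cos (n : ℕ) (k : ℝ) :
    ∫ y in Ioi (0 : ℝ), y ^ n * Real.exp (-y) * Real.cos (k * y)
      = (n.factorial / (1 - k * I) ^ (n + 1)).re := by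
  have hz : 0 < (1 - k * I : ℂ).re := by simp
  have hre : ∀ y : ℝ, y ^ n * Real.exp (-y) * Real.cos (k * y)
      = ((y : ℂ) ^ n * Complex.exp (-((1 - k * I) * y))).re := fun y => by
    have hexp : Complex.exp (-((1 - k * I) * y))
        = (Real.exp (-y) : ℂ) * Complex.exp ((k * y : ℝ) * I) := by
      rw [Complex.ofReal_exp, ← Complex.exp_add]; push_cast; ring_nf
    rw [hexp, ← mul_assoc, ← Complex.ofReal_pow, ← Complex.ofReal_mul, Complex.re_ofReal_mul,
      Complex.exp_ofReal_mul_I_re]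
  simp only [hre]
  rw [← integral_Ioi_pow_mul_cexp_neg_mul n hz]
  exact integral_re (integrableOn_pow_mul_cexp_neg_mul n hz)

/-- The even profile `(1 + σ|y|) e^{-|y|} / 4` on the line. For `σ = 1` and `σ = -1` its Fourier
transform is `1 / (1 + k²)²` and `k² / (1 + k²)²`. -/
def expProfile (σ y : ℝ) : ℝ := (1 + σ * |y|) * Real.exp (-|y|) / 4

/-- The Fourier transform of `expProfile σ`. -/
def cosMultiplier (σ k : ℝ) : ℝ := ((1 + σ) / 2 + (1 - σ) / 2 * k ^ 2) / (1 + k ^ 2) ^ 2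

theorem integral_expProfile_mul_sin (σ k : ℝ) :
    ∫ y, expProfile σ y * Real.sin (k * y) = 0 := by
  have hneg := integral_neg_eq_self (fun y => expProfile σ y * Real.sin (k * y)) volume
  simp only [expProfile, abs_neg, mul_neg, Real.sin_neg, integral_neg] at hneg ⊢
  linarith

theorem cosTransform_expProfile (σ : ℝ) :
    cosTransform volume (expProfile σ) id = cosMultiplier σ := by
  ext k
  have hint : ∀ n : ℕ, IntegrableOn (fun y : ℝ => y ^ n * Real.exp (-y) * Real.cos (k * y))
      (Ioi 0) := fun n =>
    (integrableOn_pow_mul_exp_neg n).mul_bdd (c := 1) (by fun_prop)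
      (.of_forall fun y => Real.abs_cos_le_one _)
  have habs : ∀ y, expProfile σ y * Real.cos (k * id y)
      = expProfile σ |y| * Real.cos (k * |y|) := fun y => by
    rcases abs_cases y with ⟨h, -⟩ | ⟨h, -⟩ <;> simp [expProfile, h]
  have hsplit : ∀ y ∈ Ioi (0 : ℝ), expProfile σ y * Real.cos (k * y)
      = (y ^ 0 * Real.exp (-y) * Real.cos (k * y)
        + σ * (y ^ 1 * Real.exp (-y) * Real.cos (k * y))) / 4 := fun y hy => by
    rw [expProfile, abs_of_pos hy]; ring
  have hre₀ : ((Nat.factorial 0 : ℂ) / (1 - k * I) ^ (0 + 1)).re = 1 / (1 + k ^ 2) := by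
    simp [Complex.inv_re, Complex.normSq_apply, sq]
  have hre₁ : ((Nat.factorial 1 : ℂ) / (1 - k * I) ^ (1 + 1)).re
      = (1 - k ^ 2) / (1 + k ^ 2) ^ 2 := by
    simp only [Nat.factorial_one, Nat.cast_one, Nat.reduceAdd, sq, one_div, mul_inv_rev,
      Complex.mul_re, Complex.inv_re, Complex.inv_im, Complex.sub_re, Complex.sub_im,
      Complex.one_re, Complex.one_im, Complex.mul_im, Complex.ofReal_re, Complex.ofReal_im,
      Complex.I_re, Complex.I_im, Complex.normSq_apply, mul_zero, mul_one, sub_self, sub_zero,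
      add_zero, zero_sub, mul_neg, neg_mul, neg_neg]
    field_simp
  simp only [cosTransform, habs]
  rw [integral_comp_abs (f := fun y => expProfile σ y * Real.cos (k * y)),
    setIntegral_congr_fun measurableSet_Ioi hsplit, integral_div,
    integral_add (hint 0) ((hint 1).const_mul σ), integral_const_mul,
    integral_Ioi_pow_mul_exp_neg_mul_cos, integral_Ioi_pow_mul_exp_neg_mul_cos, hre₀, hre₁,
    cosMultiplier]
  field_simp
  ring

theorem integrable_comp_abs {f : ℝ → ℝ} (hf : IntegrableOn f (Ioi 0)) :
    Integrable fun x => f |x| := by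
  have hIoi : IntegrableOn (fun x => f |x|) (Ioi 0) :=
    hf.congr_fun (fun x hx => by rw [abs_of_pos hx]) measurableSet_Ioi
  have hIio : IntegrableOn (fun x => f |x|) (Iio 0) := by
    rw [← (Measure.measurePreserving_neg (volume : Measure ℝ)).integrableOn_comp_preimage
      (Homeomorph.neg ℝ).measurableEmbedding]
    simpa [Function.comp_def] using hIoi
  rw [← integrableOn_univ, ← Iic_union_Ioi (a := (0 : ℝ))]
  exact ((integrableOn_Iic_iff_integrableOn_Iio).2 hIio).union hIoi

theorem abs_one_add_sq_mul_expProfile_le {σ : ℝ} (hσ : |σ| ≤ 1) (y : ℝ) :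
    |(1 + y ^ 2) * expProfile σ y|
      ≤ 1 / 4 * ∑ n ∈ Finset.range 4, |y| ^ n * Real.exp (-|y|) := by
  have hbd : |1 + σ * (|y|)| ≤ 1 + |y| :=
    (abs_add_le _ _).trans <| by
      rw [abs_one, abs_mul, abs_abs]
      gcongr
      exact mul_le_of_le_one_left (abs_nonneg y) hσ
  calc |(1 + y ^ 2) * expProfile σ y|
      = (1 + |y| ^ 2) * (|1 + σ * (|y|)| * Real.exp (-|y|) / 4) := by
        rw [expProfile, abs_mul, abs_of_pos (by positivity : 0 < 1 + y ^ 2), sq_abs, abs_div,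
          abs_mul, Real.abs_exp, abs_of_pos (by norm_num : (0 : ℝ) < 4)]
    _ ≤ (1 + |y| ^ 2) * ((1 + |y|) * Real.exp (-|y|) / 4) := by gcongr
    _ = 1 / 4 * ∑ n ∈ Finset.range 4, |y| ^ n * Real.exp (-|y|) := by
        simp only [Finset.sum_range_succ, Finset.sum_range_zero]; ring

theorem integrable_abs_pow_mul_exp_neg_abs (n : ℕ) :
    Integrable fun y : ℝ => |y| ^ n * Real.exp (-|y|) :=
  integrable_comp_abs (integrableOn_pow_mul_exp_neg n)

theorem integrable_one_add_sq_mul_expProfile {σ : ℝ} (hσ : |σ| ≤ 1) :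
    Integrable fun y => (1 + y ^ 2) * expProfile σ y :=
  ((integrable_finsetSum _ fun n _ => integrable_abs_pow_mul_exp_neg_abs n).const_mul _).mono'
    (by unfold expProfile; fun_prop) (.of_forall (abs_one_add_sq_mul_expProfile_le hσ))

theorem integral_abs_one_add_sq_mul_expProfile_le {σ : ℝ} (hσ : |σ| ≤ 1) :
    ∫ y, |(1 + y ^ 2) * expProfile σ y| ≤ 5 := by
  calc ∫ y, |(1 + y ^ 2) * expProfile σ y|
      ≤ ∫ y : ℝ, 1 / 4 * ∑ n ∈ Finset.range 4, |y| ^ n * Real.exp (-|y|) :=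
        integral_mono (integrable_one_add_sq_mul_expProfile hσ).abs
          ((integrable_finsetSum _ fun n _ => integrable_abs_pow_mul_exp_neg_abs n).const_mul _)
          (abs_one_add_sq_mul_expProfile_le hσ)
    _ = 1 / 4 * ∑ n ∈ Finset.range 4, 2 * (n.factorial : ℝ) := by
        rw [integral_const_mul,
          integral_finsetSum _ fun n _ => integrable_abs_pow_mul_exp_neg_abs n]
        congr 1
        refine Finset.sum_congr rfl fun n _ => ?_
        rw [integral_comp_abs (f := fun y => y ^ n * Real.exp (-y)), integral_Ioi_pow_mul_exp_neg]
    _ = 5 := by norm_num [Finset.sum_range_succ, Nat.factorial]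

theorem abs_cosMultiplier_le {σ : ℝ} (hσ : |σ| ≤ 1) (k : ℝ) :
    |cosMultiplier σ k| ≤ (1 + k ^ 2)⁻¹ := by
  obtain ⟨h₁, h₂⟩ := abs_le.1 hσ
  have hnum : 0 ≤ (1 + σ) / 2 + (1 - σ) / 2 * k ^ 2 := by
    have := mul_nonneg (by linarith : 0 ≤ (1 - σ) / 2) (sq_nonneg k)
    linarith
  rw [cosMultiplier, abs_of_nonneg (by positivity), div_le_iff₀ (by positivity)]
  field_simp
  nlinarith [sq_nonneg k]

theorem integrable_cosMultiplier {σ : ℝ} (hσ : |σ| ≤ 1) : Integrable (cosMultiplier σ) := by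
  have hmeas : Measurable (cosMultiplier σ) := by unfold cosMultiplier; fun_prop
  exact integrable_inv_one_add_sq.mono' hmeas.aestronglyMeasurable
    (.of_forall (abs_cosMultiplier_le hσ))

theorem hasStationaryPhase_cosMultiplier_mul_cosTransform {α : Type*} [MeasurableSpace α]
    {μ : Measure α} [SFinite μ] {Q z : α → ℝ} {σ : ℝ} (hσ : |σ| ≤ 1)
    (hz : AEStronglyMeasurable z μ) (hQ : Integrable (fun x => (1 + z x ^ 2) * Q x) μ) :
    HasStationaryPhase (fun k => cosMultiplier σ k * cosTransform μ Q z k)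
      ((1 + σ) / 2 * ∫ x, Q x ∂μ) (5 / 4 * ∫ x, |(1 + z x ^ 2) * Q x| ∂μ) 0 := by
  have hprofile : ∫ y, expProfile σ y = (1 + σ) / 2 := by
    have h := congrFun (cosTransform_expProfile σ) 0
    simpa [cosTransform, cosMultiplier] using h
  have h := hasStationaryPhase_cosTransform_mul (y := id) (by fun_prop)
    (integrable_one_add_sq_mul_expProfile hσ) hz hQ (integral_expProfile_mul_sin σ)
    (by rw [cosTransform_expProfile]; exact (integrable_cosMultiplier hσ).integrableOn)
  rw [cosTransform_expProfile, hprofile] at h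
  refine h.mono ?_ le_rfl
  calc _ ≤ 1 / 4 * (5 * ∫ x, |(1 + z x ^ 2) * Q x| ∂μ) := by
        gcongr; exact integral_abs_one_add_sq_mul_expProfile_le hσ
    _ = _ := by ring

/-- Measurable functions on the half line that are bounded by `M / (1 + x²)²`. -/
structure FastDecay (M : ℝ) (F : ℝ → ℝ) : Prop where
  aestronglyMeasurable : AEStronglyMeasurable F (volume.restrict (Ioi 0))
  abs_le_mul_inv_sq : ∀ x, 0 < x → |F x| ≤ M * ((1 + x ^ 2) ^ 2)⁻¹

namespace FastDecay

variable {M N c : ℝ} {F G : ℝ → ℝ}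

theorem add (hF : FastDecay M F) (hG : FastDecay N G) : FastDecay (M + N) fun x => F x + G x where
  aestronglyMeasurable := hF.aestronglyMeasurable.add hG.aestronglyMeasurable
  abs_le_mul_inv_sq x hx := (abs_add_le _ _).trans <| by
    rw [add_mul]
    exact add_le_add (hF.abs_le_mul_inv_sq x hx) (hG.abs_le_mul_inv_sq x hx)

theorem mul_left (hF : FastDecay M F) (hG : AEStronglyMeasurable G (volume.restrict (Ioi 0)))
    (hc : ∀ x, 0 < x → |G x| ≤ c) : FastDecay (c * M) fun x => G x * F x where
  aestronglyMeasurable := hG.mul hF.aestronglyMeasurable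
  abs_le_mul_inv_sq x hx := by
    rw [abs_mul, mul_assoc]
    exact mul_le_mul (hc x hx) (hF.abs_le_mul_inv_sq x hx) (abs_nonneg _)
      ((abs_nonneg _).trans (hc x hx))

theorem neg (hF : FastDecay M F) : FastDecay M fun x => -F x where
  aestronglyMeasurable := hF.aestronglyMeasurable.neg
  abs_le_mul_inv_sq x hx := (abs_neg (F x)).trans_le (hF.abs_le_mul_inv_sq x hx)

theorem abs_mul_le (hF : FastDecay M F) {g x : ℝ} (hx : 0 < x) (hg : |g| ≤ c * (1 + x ^ 2)) :
    |g * F x| ≤ c * M * (1 + x ^ 2)⁻¹ := by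
  calc |g * F x| ≤ c * (1 + x ^ 2) * (M * ((1 + x ^ 2) ^ 2)⁻¹) := by
        rw [abs_mul]
        exact mul_le_mul hg (hF.abs_le_mul_inv_sq x hx) (abs_nonneg _) ((abs_nonneg _).trans hg)
    _ = c * M * (1 + x ^ 2)⁻¹ := by field_simp

theorem nonneg (hF : FastDecay M F) : 0 ≤ M :=
  nonneg_of_mul_nonneg_left ((abs_nonneg _).trans (hF.abs_le_mul_inv_sq 1 one_pos))
    (by positivity)

theorem abs_le (hF : FastDecay M F) {x : ℝ} (hx : 0 < x) : |F x| ≤ M := by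
  refine (hF.abs_le_mul_inv_sq x hx).trans (mul_le_of_le_one_right hF.nonneg ?_)
  exact inv_le_one_of_one_le₀ (one_le_pow₀ (by linarith [sq_nonneg x]))

theorem integrableOn_mul (hF : FastDecay M F)
    (hG : AEStronglyMeasurable G (volume.restrict (Ioi 0)))
    (hc : ∀ x, 0 < x → |G x| ≤ c * (1 + x ^ 2)) : IntegrableOn (fun x => G x * F x) (Ioi 0) := by
  refine (integrable_inv_one_add_sq.integrableOn.const_mul (c * M)).mono'
    (hG.mul hF.aestronglyMeasurable) ?_
  filter_upwards [ae_restrict_mem measurableSet_Ioi] with x hx using hF.abs_mul_le hx (hc x hx)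

theorem integral_abs_mul_le (hF : FastDecay M F) (hc0 : 0 ≤ c)
    (hc : ∀ x, 0 < x → |G x| ≤ c * (1 + x ^ 2)) :
    ∫ x in Ioi 0, |G x * F x| ≤ 2 * c * M := by
  have hle : ∫ x in Ioi 0, |G x * F x| ≤ ∫ x in Ioi (0 : ℝ), c * M * (1 + x ^ 2)⁻¹ := by
    refine integral_mono_of_nonneg (.of_forall fun x => abs_nonneg _)
      (integrable_inv_one_add_sq.integrableOn.const_mul _) ?_
    filter_upwards [ae_restrict_mem measurableSet_Ioi] with x hx using hF.abs_mul_le hx (hc x hx)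
  rw [integral_const_mul, integral_Ioi_inv_one_add_sq, Real.arctan_zero, sub_zero] at hle
  nlinarith [Real.pi_lt_four, mul_nonneg hc0 hF.nonneg]

theorem abs_integral_mul_le (hF : FastDecay M F) (hc0 : 0 ≤ c)
    (hc : ∀ x, 0 < x → |G x| ≤ c * (1 + x ^ 2)) :
    |∫ x in Ioi 0, G x * F x| ≤ 2 * c * M :=
  abs_integral_le_integral_abs.trans (hF.integral_abs_mul_le hc0 hc)

theorem integrableOn (hF : FastDecay M F) : IntegrableOn F (Ioi 0) := by
  have h := hF.integrableOn_mul (G := fun _ => 1) (c := 1) aestronglyMeasurable_const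
    fun x _ => by rw [abs_one]; linarith [sq_nonneg x]
  simpa only [one_mul] using h

theorem hasStationaryPhase_cosMultiplier_mul (hF : FastDecay M F) {σ : ℝ} (hσ : |σ| ≤ 1)
    {z : ℝ → ℝ} (hz : AEStronglyMeasurable z (volume.restrict (Ioi 0)))
    (hzx : ∀ x, 0 < x → |z x| ≤ x) :
    HasStationaryPhase (fun k => cosMultiplier σ k * cosTransform (volume.restrict (Ioi 0)) F z k)
      ((1 + σ) / 2 * ∫ x in Ioi 0, F x) (5 / 2 * M) 0 := by
  have hweight : ∀ x, 0 < x → |1 + z x ^ 2| ≤ 1 * (1 + x ^ 2) := fun x hx => by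
    rw [abs_of_pos (by positivity), one_mul, add_le_add_iff_left, sq_le_sq, abs_of_pos hx]
    exact hzx x hx
  refine (hasStationaryPhase_cosMultiplier_mul_cosTransform hσ hz
    (hF.integrableOn_mul (by fun_prop) hweight)).mono ?_ le_rfl
  linarith [hF.integral_abs_mul_le zero_le_one hweight]

end FastDecay

theorem hasDerivAt_tanh (x : ℝ) : HasDerivAt Real.tanh (1 - Real.tanh x ^ 2) x := by
  have hcosh := (Real.cosh_pos x).ne'
  rw [funext Real.tanh_eq_sinh_div_cosh]
  refine ((Real.hasDerivAt_sinh x).div (Real.hasDerivAt_cosh x) hcosh).congr_deriv ?_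
  field_simp

@[fun_prop]
theorem continuous_tanh : Continuous Real.tanh :=
  continuous_iff_continuousAt.2 fun x => (hasDerivAt_tanh x).continuousAt

theorem tanh_add_mul (x y : ℝ) :
    Real.tanh (x + y) * (1 + Real.tanh x * Real.tanh y) = Real.tanh x + Real.tanh y := by
  have hx := (Real.cosh_pos x).ne'
  have hy := (Real.cosh_pos y).ne'
  have hxy := (Real.cosh_pos (x + y)).ne'
  simp only [Real.tanh_eq_sinh_div_cosh]
  field_simp
  rw [Real.cosh_add, Real.sinh_add]
  ring

theorem abs_tanh_add_theta_sub_le {q : ℝ} (hq : |q| < 1) (x : ℝ) :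
    |Real.tanh (x + theta q) - Real.tanh x| ≤ 2 * |q| := by
  have haddition := tanh_add_mul x (theta q)
  rw [tanh_theta hq] at haddition
  have hx := Real.abs_tanh_lt_one x
  have hmul : |Real.tanh x * q| ≤ |Real.tanh x| := by
    rw [abs_mul]; exact mul_le_of_le_one_right (abs_nonneg _) hq.le
  have hpos : 0 < 1 - |Real.tanh x| := by linarith
  have hfactor : (Real.tanh (x + theta q) - Real.tanh x) * (1 + Real.tanh x * q)
      = q * ((1 - |Real.tanh x|) * (1 + |Real.tanh x|)) := by
    linear_combination haddition + q * sq_abs (Real.tanh x)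
  refine le_of_mul_le_mul_right ?_ hpos
  calc |Real.tanh (x + theta q) - Real.tanh x| * (1 - |Real.tanh x|)
      ≤ |Real.tanh (x + theta q) - Real.tanh x| * |1 + Real.tanh x * q| := by
        gcongr
        exact (by linarith [neg_abs_le (Real.tanh x * q)] :
          1 - |Real.tanh x| ≤ 1 + Real.tanh x * q).trans (le_abs_self _)
    _ = |q| * ((1 - |Real.tanh x|) * (1 + |Real.tanh x|)) := by
        rw [← abs_mul, hfactor, abs_mul, abs_of_nonneg (a := (1 - |Real.tanh x|) * _)]
        positivity
    _ ≤ |q| * ((1 - |Real.tanh x|) * 2) := by gcongr; linarith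
    _ = 2 * |q| * (1 - |Real.tanh x|) := by ring

theorem FastDecay.integral_mul_eq_neg {F F' g g' : ℝ → ℝ} {M N c c' : ℝ} (hF : FastDecay M F)
    (hF' : FastDecay N F') (hFF' : ∀ x, 0 < x → HasDerivAt F (F' x) x)
    (hgg' : ∀ x, HasDerivAt g (g' x) x) (hg₀ : g 0 = 0) (hg : ∀ x, |g x| ≤ c)
    (hg' : ∀ x, |g' x| ≤ c') :
    ∫ x in Ioi 0, g' x * F x = -∫ x in Ioi 0, g x * F' x := by
  have hgcont : Continuous g := continuous_iff_continuousAt.2 fun x => (hgg' x).continuousAt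
  have hg'meas : Measurable g' := by
    rw [← funext fun x => (hgg' x).deriv]; exact measurable_deriv g
  have hgF := hF.mul_left hgcont.aestronglyMeasurable fun x _ => hg x
  have hgF' := (hF'.mul_left hgcont.aestronglyMeasurable fun x _ => hg x).integrableOn
  have hg'F := (hF.mul_left hg'meas.aestronglyMeasurable fun x _ => hg' x).integrableOn
  have hzero : Tendsto (g * F) (𝓝[>] 0) (𝓝 0) := by
    have hg0 : Tendsto g (𝓝[>] 0) (𝓝 0) := by
      simpa [hg₀] using (hgcont.tendsto 0).mono_left nhdsWithin_le_nhds
    refine hg0.zero_mul_isBoundedUnder_le (isBoundedUnder_of_eventually_le (a := M) ?_)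
    filter_upwards [self_mem_nhdsWithin] with x hx using hF.abs_le hx
  have hinfty : Tendsto (g * F) atTop (𝓝 0) :=
    tendsto_zero_of_hasDerivAt_of_integrableOn_Ioi (a := 0)
      (fun x hx => (hgg' x).mul (hFF' x hx)) (hg'F.add hgF') hgF.integrableOn
  have hparts := integral_Ioi_mul_deriv_eq_deriv_mul (fun x _ => hgg' x) hFF' hgF' hg'F hzero hinfty
  linarith

/-- The data class of the theorem: twice differentiable functions on the half line whose first
two derivatives decay like the function itself. -/
structure FastDecayC2 (M : ℝ) (w : ℝ → ℝ) : Prop where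
  fastDecay : FastDecay M w
  fastDecay_deriv : FastDecay M (deriv w)
  fastDecay_deriv_deriv : FastDecay M (deriv (deriv w))
  differentiableAt : ∀ x, 0 < x → DifferentiableAt ℝ w x
  differentiableAt_deriv : ∀ x, 0 < x → DifferentiableAt ℝ (deriv w) x

/-- Up to elementary factors in `k`, the real kernel that maps `w₀` to its distorted transform
`f(k)`, with `sin (k x) / k` in place of `sin (k x)` so that it is regular at `k = 0`. -/
def kernel (q k x : ℝ) : ℝ :=
  (q * (1 - k ^ 2) + 2 * k ^ 2 * Real.tanh (x + theta q)) * (Real.sin (k * x) / k)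
    + (1 - k ^ 2 - 2 * q * Real.tanh (x + theta q)) * Real.cos (k * x)

/-- The transform of `w` against `kernel q`. -/
def kernelTransform (q : ℝ) (w : ℝ → ℝ) (k : ℝ) : ℝ := ∫ x in Ioi 0, kernel q k x * w x

/-- The function `w' + (2 tanh(x + θ) - q) w`, whose sine transform collects the terms of
`kernelTransform q w` that grow with `k`. -/
def flux (q : ℝ) (w : ℝ → ℝ) (x : ℝ) : ℝ := deriv w x + (2 * Real.tanh (x + theta q) - q) * w x

/-- The derivative of `flux q w`. -/
def fluxDeriv (q : ℝ) (w : ℝ → ℝ) (x : ℝ) : ℝ :=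
  deriv (deriv w) x + ((2 * Real.tanh (x + theta q) - q) * deriv w x
    + 2 * (1 - Real.tanh (x + theta q) ^ 2) * w x)

theorem abs_sin_mul_div_le (k : ℝ) {x : ℝ} (hx : 0 < x) : |Real.sin (k * x) / k| ≤ x := by
  rw [abs_div]
  refine div_le_of_le_mul₀ (abs_nonneg k) hx.le (Real.abs_sin_le_abs.trans_eq ?_)
  rw [abs_mul, abs_of_pos hx, mul_comm]

theorem abs_cos_sub_one_le (x : ℝ) : |Real.cos x - 1| ≤ 2 := by
  rw [abs_le]; constructor <;> linarith [Real.cos_le_one x, Real.neg_one_le_cos x]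

theorem abs_sin_div_sub_tanh_mul_cos_le (q k : ℝ) {x : ℝ} (hx : 0 < x) :
    |q * (Real.sin (k * x) / k) - 2 * q * Real.tanh (x + theta q) * Real.cos (k * x)|
      ≤ 3 * |q| * (1 + x ^ 2) := by
  have hcos : |2 * q * Real.tanh (x + theta q) * Real.cos (k * x)| ≤ 2 * |q| := by
    rw [abs_mul, abs_mul, abs_mul, abs_two, mul_assoc]
    exact mul_le_of_le_one_right (by positivity) (mul_le_one₀ (Real.abs_tanh_lt_one _).le
      (abs_nonneg _) (Real.abs_cos_le_one _))
  have hsin : |q * (Real.sin (k * x) / k)| ≤ |q| * x := by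
    rw [abs_mul]
    gcongr
    exact abs_sin_mul_div_le k hx
  have hpoly : x + 2 ≤ 3 * (1 + x ^ 2) := by nlinarith [sq_nonneg (x - 1)]
  calc _ ≤ |q| * x + 2 * |q| := (abs_sub _ _).trans (add_le_add hsin hcos)
    _ = |q| * (x + 2) := by ring
    _ ≤ |q| * (3 * (1 + x ^ 2)) := by gcongr
    _ = 3 * |q| * (1 + x ^ 2) := by ring

theorem abs_two_mul_tanh_sub_le {q : ℝ} (hq : |q| < 1) (x : ℝ) : |2 * Real.tanh x - q| ≤ 3 := by
  have htanh := abs_lt.1 (Real.abs_tanh_lt_one x)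
  rw [abs_le]
  constructor <;> linarith [abs_lt.1 hq]

namespace FastDecayC2

variable {M q : ℝ} {w : ℝ → ℝ}

theorem hasDerivAt_flux (hw : FastDecayC2 M w) (q : ℝ) {x : ℝ} (hx : 0 < x) :
    HasDerivAt (flux q w) (fluxDeriv q w x) x := by
  have htanh := (((hasDerivAt_tanh _).comp_add_const x (theta q)).const_mul 2).sub_const q
  refine ((hw.differentiableAt_deriv x hx).hasDerivAt.add
    (htanh.mul (hw.differentiableAt x hx).hasDerivAt)).congr_deriv ?_
  rw [fluxDeriv]
  ring

theorem fastDecay_flux (hw : FastDecayC2 M w) (hq : |q| < 1) : FastDecay (M + 3 * M) (flux q w) :=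
  hw.fastDecay_deriv.add (hw.fastDecay.mul_left (by fun_prop) fun _ _ =>
    abs_two_mul_tanh_sub_le hq _)

theorem fastDecay_fluxDeriv (hw : FastDecayC2 M w) (hq : |q| < 1) :
    FastDecay (M + (3 * M + 2 * M)) (fluxDeriv q w) := by
  refine hw.fastDecay_deriv_deriv.add ((hw.fastDecay_deriv.mul_left (by fun_prop) fun _ _ =>
    abs_two_mul_tanh_sub_le hq _).add (hw.fastDecay.mul_left (by fun_prop) fun x _ => ?_))
  rw [abs_le]
  constructor <;> nlinarith [Real.tanh_sq_lt_one (x + theta q), sq_nonneg (Real.tanh (x + theta q))]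

theorem fastDecay_fluxDeriv_sub (hw : FastDecayC2 M w) (hq : |q| < 1) :
    FastDecay (5 * |q| * M + 8 * |q| * M) fun x => fluxDeriv q w x - fluxDeriv 0 w x := by
  have hsub : ∀ x, fluxDeriv q w x - fluxDeriv 0 w x
      = (2 * (Real.tanh (x + theta q) - Real.tanh x) - q) * deriv w x
        + -(2 * (Real.tanh (x + theta q) - Real.tanh x)
          * (Real.tanh (x + theta q) + Real.tanh x)) * w x := fun x => by
    simp only [fluxDeriv, theta, Real.artanh_zero, add_zero]
    ring
  simp only [hsub]
  refine (hw.fastDecay_deriv.mul_left (by fun_prop) fun x _ => ?_).add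
    (hw.fastDecay.mul_left (by fun_prop) fun x _ => ?_)
  · refine (abs_sub _ _).trans ?_
    rw [abs_mul, abs_two]
    linarith [abs_tanh_add_theta_sub_le hq x]
  · have hsum : |Real.tanh (x + theta q) + Real.tanh x| ≤ 2 := (abs_add_le _ _).trans (by
      linarith [Real.abs_tanh_lt_one (x + theta q), Real.abs_tanh_lt_one x])
    rw [abs_neg, abs_mul, abs_mul, abs_two]
    calc _ ≤ 2 * (2 * |q|) * 2 := by gcongr; exact abs_tanh_add_theta_sub_le hq x
      _ = 8 * |q| := by ring

end FastDecayC2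

namespace FastDecay

variable {M N : ℝ} {w S : ℝ → ℝ}

theorem integrableOn_cos_mul (hS : FastDecay M S) (k : ℝ) :
    IntegrableOn (fun x => Real.cos (k * x) * S x) (Ioi 0) :=
  (hS.mul_left (by fun_prop) fun _ _ => Real.abs_cos_le_one _).integrableOn

theorem integrableOn_cos_sub_one_mul (hS : FastDecay M S) (k : ℝ) :
    IntegrableOn (fun x => (Real.cos (k * x) - 1) * S x) (Ioi 0) :=
  (hS.mul_left (by fun_prop) fun _ _ => abs_cos_sub_one_le _).integrableOn

theorem abs_integral_cos_mul_le (hS : FastDecay M S) (k : ℝ) :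
    |∫ x in Ioi 0, Real.cos (k * x) * S x| ≤ 2 * M := by
  have h := hS.abs_integral_mul_le (G := fun x => Real.cos (k * x)) zero_le_one fun x _ => by
    linarith [Real.abs_cos_le_one (k * x), sq_nonneg x]
  rwa [mul_one] at h

theorem abs_integral_cos_sub_one_mul_le (hS : FastDecay M S) (k : ℝ) :
    |∫ x in Ioi 0, (Real.cos (k * x) - 1) * S x| ≤ 4 * M := by
  have h := hS.abs_integral_mul_le (G := fun x => Real.cos (k * x) - 1) zero_le_two fun x _ => by
    linarith [abs_cos_sub_one_le (k * x), sq_nonneg x]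
  linarith

theorem hasStationaryPhase_cosMultiplier_mul_cos_add_cos_sub_one (hw : FastDecay M w)
    (hS : FastDecay N S) {σ : ℝ} (hσ : |σ| ≤ 1) :
    HasStationaryPhase (fun k => cosMultiplier σ k * ((∫ x in Ioi 0, Real.cos (k * x) * w x)
        + ∫ x in Ioi 0, (Real.cos (k * x) - 1) * S x))
      ((1 + σ) / 2 * ∫ x in Ioi 0, w x) (5 / 2 * (M + 2 * N)) 0 := by
  have hcos := (hw.add hS).hasStationaryPhase_cosMultiplier_mul hσ (z := id) (by fun_prop)
    fun x hx => (abs_of_pos hx).le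
  have hconst := hS.neg.hasStationaryPhase_cosMultiplier_mul hσ (z := fun _ => 0) (by fun_prop)
    fun x hx => by simpa using hx.le
  have htransform : ∀ k, (∫ x in Ioi 0, Real.cos (k * x) * w x)
      + ∫ x in Ioi 0, (Real.cos (k * x) - 1) * S x
      = cosTransform (volume.restrict (Ioi 0)) (fun x => w x + S x) id k
        + cosTransform (volume.restrict (Ioi 0)) (fun x => -S x) (fun _ => 0) k := fun k => by
    simp only [cosTransform, id_eq, mul_zero, Real.cos_zero, mul_one, mul_comm _ (Real.cos _)]
    rw [← integral_add (hw.integrableOn_cos_mul k) (hS.integrableOn_cos_sub_one_mul k),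
      ← integral_add ((hw.add hS).integrableOn_cos_mul k) hS.neg.integrableOn]
    congr with x
    ring
  simp only [htransform, mul_add (cosMultiplier σ _)]
  convert (hcos.add hconst).mono (le_of_eq _) (add_zero 0).le using 1
  · rw [integral_add hw.integrableOn hS.integrableOn, integral_neg]
    ring
  · ring

end FastDecay

namespace FastDecayC2

variable {M q : ℝ} {w : ℝ → ℝ}

theorem sq_mul_integral_cos_mul (hw : FastDecayC2 M w) (k : ℝ) :
    k ^ 2 * ∫ x in Ioi 0, Real.cos (k * x) * w x
      = -∫ x in Ioi 0, k * Real.sin (k * x) * deriv w x := by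
  have hparts := hw.fastDecay.integral_mul_eq_neg hw.fastDecay_deriv
    (fun x hx => (hw.differentiableAt x hx).hasDerivAt) (g := fun x => k * Real.sin (k * x))
    (g' := fun x => k ^ 2 * Real.cos (k * x)) (c := |k|) (c' := k ^ 2)
    (fun x => (((Real.hasDerivAt_sin (k * x)).comp x (hasDerivAt_const_mul k)).const_mul k
      |>.congr_deriv (by ring)))
    (by simp) (fun x => ?_) (fun x => ?_)
  · rw [← hparts, ← integral_const_mul]
    simp only [mul_assoc]
  · rw [abs_mul]
    exact mul_le_of_le_one_right (abs_nonneg k) (Real.abs_sin_le_one _)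
  · rw [abs_mul, abs_of_nonneg (sq_nonneg k)]
    exact mul_le_of_le_one_right (sq_nonneg k) (Real.abs_cos_le_one _)

theorem integral_sin_mul_flux (hw : FastDecayC2 M w) (hq : |q| < 1) (k : ℝ) :
    ∫ x in Ioi 0, k * Real.sin (k * x) * flux q w x
      = ∫ x in Ioi 0, (Real.cos (k * x) - 1) * fluxDeriv q w x := by
  have hparts := (hw.fastDecay_flux hq).integral_mul_eq_neg (hw.fastDecay_fluxDeriv hq)
    (fun x hx => hw.hasDerivAt_flux q hx) (g := fun x => 1 - Real.cos (k * x))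
    (g' := fun x => k * Real.sin (k * x)) (c := 2) (c' := |k|)
    (fun x => ((Real.hasDerivAt_cos (k * x)).comp x (hasDerivAt_const_mul k)).const_sub 1
      |>.congr_deriv (by ring))
    (by simp) (fun x => by rw [abs_sub_comm]; exact abs_cos_sub_one_le _) (fun x => ?_)
  · rw [hparts, ← integral_neg]
    congr with x
    ring
  · rw [abs_mul]
    exact mul_le_of_le_one_right (abs_nonneg k) (Real.abs_sin_le_one _)

theorem kernelTransform_eq (hw : FastDecayC2 M w) (hq : |q| < 1) {k : ℝ} (hk : k ≠ 0) :
    kernelTransform q w k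
      = (∫ x in Ioi 0, (q * (Real.sin (k * x) / k)
          - 2 * q * Real.tanh (x + theta q) * Real.cos (k * x)) * w x)
        + ((∫ x in Ioi 0, Real.cos (k * x) * w x)
          + ∫ x in Ioi 0, (Real.cos (k * x) - 1) * fluxDeriv q w x) := by
  have hsin : ∀ x, |k * Real.sin (k * x)| ≤ |k| := fun x => by
    rw [abs_mul]
    exact mul_le_of_le_one_right (abs_nonneg k) (Real.abs_sin_le_one _)
  have hsmall := hw.fastDecay.integrableOn_mul (by fun_prop)
    fun x hx => abs_sin_div_sub_tanh_mul_cos_le q k hx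
  have hcos := hw.fastDecay.integrableOn_cos_mul k
  have hflux := ((hw.fastDecay_flux hq).mul_left (by fun_prop) fun x _ => hsin x).integrableOn
  have hderiv := (hw.fastDecay_deriv.mul_left (by fun_prop) fun x _ => hsin x).integrableOn
  have hsplit : ∀ x, kernel q k x * w x
      = (q * (Real.sin (k * x) / k)
          - 2 * q * Real.tanh (x + theta q) * Real.cos (k * x)) * w x
        + (Real.cos (k * x) * w x + k * Real.sin (k * x) * flux q w x)
        - (k * Real.sin (k * x) * deriv w x + k ^ 2 * (Real.cos (k * x) * w x)) := fun x => by
    rw [kernel, flux]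
    field_simp
    ring
  simp only [kernelTransform, hsplit]
  have hplus := Integrable.fun_add hcos hflux
  have hminus := Integrable.fun_add hderiv (hcos.const_mul (k ^ 2))
  rw [integral_sub (Integrable.fun_add hsmall hplus) hminus, integral_add hsmall hplus,
    integral_add hcos hflux, integral_add hderiv (hcos.const_mul _), integral_const_mul,
    hw.sq_mul_integral_cos_mul, hw.integral_sin_mul_flux hq]
  ring

theorem kernelTransform_zero_eq (hw : FastDecayC2 M w) {k : ℝ} (hk : k ≠ 0) :
    kernelTransform 0 w k = (∫ x in Ioi 0, Real.cos (k * x) * w x)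
      + ∫ x in Ioi 0, (Real.cos (k * x) - 1) * fluxDeriv 0 w x := by
  simpa using hw.kernelTransform_eq (q := 0) (by simp) hk

theorem abs_kernelTransform_zero_le (hw : FastDecayC2 M w) {k : ℝ} (hk : k ≠ 0) :
    |kernelTransform 0 w k| ≤ 26 * M := by
  rw [hw.kernelTransform_zero_eq hk]
  refine (abs_add_le _ _).trans ?_
  linarith [hw.fastDecay.abs_integral_cos_mul_le k,
    (hw.fastDecay_fluxDeriv (q := 0) (by simp)).abs_integral_cos_sub_one_mul_le k]

theorem abs_kernelTransform_sub_kernelTransform_zero_le (hw : FastDecayC2 M w) (hq : |q| < 1)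
    {k : ℝ} (hk : k ≠ 0) :
    |kernelTransform q w k - kernelTransform 0 w k| ≤ 58 * |q| * M := by
  have hsmall := hw.fastDecay.abs_integral_mul_le (by positivity)
    fun x hx => abs_sin_div_sub_tanh_mul_cos_le q k hx
  have hflux := (hw.fastDecay_fluxDeriv_sub hq).abs_integral_cos_sub_one_mul_le k
  simp only [mul_sub] at hflux
  rw [integral_sub ((hw.fastDecay_fluxDeriv hq).integrableOn_cos_sub_one_mul k)
    ((hw.fastDecay_fluxDeriv (by simp)).integrableOn_cos_sub_one_mul k)] at hflux
  rw [hw.kernelTransform_eq hq hk, hw.kernelTransform_zero_eq hk, add_sub_assoc,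
    add_sub_add_left_eq_sub]
  refine (abs_add_le _ _).trans ?_
  linarith

end FastDecayC2

theorem FastDecay.aestronglyMeasurable_kernelTransform {M : ℝ} {w : ℝ → ℝ} (hw : FastDecay M w)
    (q : ℝ) : AEStronglyMeasurable (kernelTransform q w) (volume.restrict (Ioi 0)) := by
  have hkernel : Measurable fun p : ℝ × ℝ => kernel q p.1 p.2 := by
    unfold kernel
    fun_prop
  exact (hkernel.aestronglyMeasurable.mul hw.aestronglyMeasurable.comp_snd).integral_prod_right'

theorem sq_div_sq_add_sq_eq {q : ℝ} (hq : q ≠ 0) (k : ℝ) :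
    q ^ 2 / (k ^ 2 + q ^ 2) = (1 + (q⁻¹ * k) ^ 2)⁻¹ := by
  field_simp
  ring

theorem integrable_sq_div_sq_add_sq (q : ℝ) : Integrable fun k : ℝ => q ^ 2 / (k ^ 2 + q ^ 2) := by
  rcases eq_or_ne q 0 with rfl | hq
  · simp
  · simp only [sq_div_sq_add_sq_eq hq]
    exact integrable_inv_one_add_sq.comp_mul_left' (inv_ne_zero hq)

theorem integral_Ioi_sq_div_sq_add_sq (q : ℝ) :
    ∫ k in Ioi (0 : ℝ), q ^ 2 / (k ^ 2 + q ^ 2) = |q| * (Real.pi / 2) := by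
  rcases eq_or_ne q 0 with rfl | hq
  · simp
  · simp only [← sq_abs q, sq_div_sq_add_sq_eq (abs_ne_zero.2 hq)]
    rw [integral_comp_mul_left_Ioi (fun u => (1 + u ^ 2)⁻¹) 0 (inv_pos.2 (abs_pos.2 hq)),
      mul_zero, integral_Ioi_inv_one_add_sq, inv_inv, smul_eq_mul, Real.arctan_zero, sub_zero]

/-- The multiplier `(1 - q²) k² / ((k² + q²) (1 + k²)²)` in front of the resonant phase; it tends
to `cosMultiplier 1` as `q → 0`, but not uniformly near `k = 0`. -/
def resonantMultiplier (q k : ℝ) : ℝ := (1 - q ^ 2) * k ^ 2 / ((k ^ 2 + q ^ 2) * (1 + k ^ 2) ^ 2)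

theorem abs_resonantMultiplier_le {q : ℝ} (hq : |q| < 1) (k : ℝ) :
    |resonantMultiplier q k| ≤ (1 + k ^ 2)⁻¹ := by
  have hq' : 0 ≤ 1 - q ^ 2 := sub_nonneg.2 ((sq_le_one_iff_abs_le_one q).2 hq.le)
  rw [resonantMultiplier, abs_of_nonneg (by positivity)]
  refine div_le_of_le_mul₀ (by positivity) (by positivity) ?_
  calc (1 - q ^ 2) * k ^ 2 ≤ (k ^ 2 + q ^ 2) * (1 + k ^ 2) := by
        nlinarith [mul_nonneg (sq_nonneg q) (sq_nonneg k), sq_nonneg q, sq_nonneg (k ^ 2)]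
    _ = (1 + k ^ 2)⁻¹ * ((k ^ 2 + q ^ 2) * (1 + k ^ 2) ^ 2) := by field_simp

theorem abs_resonantMultiplier_sub_le (q : ℝ) {k : ℝ} (hk : k ≠ 0) :
    |resonantMultiplier q k - cosMultiplier 1 k| ≤ q ^ 2 / (k ^ 2 + q ^ 2) := by
  have hsub : resonantMultiplier q k - cosMultiplier 1 k
      = -(q ^ 2 / (k ^ 2 + q ^ 2) * (1 + k ^ 2)⁻¹) := by
    rw [resonantMultiplier, cosMultiplier]
    field_simp
    ring
  rw [hsub, abs_neg, abs_of_nonneg (by positivity)]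
  exact mul_le_of_le_one_right (by positivity)
    (inv_le_one_of_one_le₀ (le_add_of_nonneg_right (sq_nonneg k)))

namespace FastDecayC2

variable {M q σ : ℝ} {w r : ℝ → ℝ}

theorem abs_mul_kernelTransform_sub_le (hw : FastDecayC2 M w) (hq : |q| < 1) {k : ℝ} (hk : k ≠ 0)
    (hr : |r k| ≤ (1 + k ^ 2)⁻¹)
    (hrσ : |r k - cosMultiplier σ k| ≤ q ^ 2 / (k ^ 2 + q ^ 2)) :
    |r k * kernelTransform q w k - cosMultiplier σ k * kernelTransform 0 w k|
      ≤ 58 * |q| * M * (1 + k ^ 2)⁻¹ + 26 * M * (q ^ 2 / (k ^ 2 + q ^ 2)) := by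
  calc _ = |(kernelTransform q w k - kernelTransform 0 w k) * r k
        + kernelTransform 0 w k * (r k - cosMultiplier σ k)| := by ring_nf
    _ ≤ |kernelTransform q w k - kernelTransform 0 w k| * |r k|
        + |kernelTransform 0 w k| * |r k - cosMultiplier σ k| := by
      rw [← abs_mul, ← abs_mul]
      exact abs_add_le _ _
    _ ≤ _ := by
      have := hw.fastDecay.nonneg
      gcongr
      · exact hw.abs_kernelTransform_sub_kernelTransform_zero_le hq hk
      · exact hw.abs_kernelTransform_zero_le hk

theorem hasStationaryPhase_mul_kernelTransform (hw : FastDecayC2 M w) (hq : |q| < 1)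
    (hσ : |σ| ≤ 1) (hrmeas : Measurable r) (hr : ∀ k, 0 < k → |r k| ≤ (1 + k ^ 2)⁻¹)
    (hrσ : ∀ k, 0 < k → |r k - cosMultiplier σ k| ≤ q ^ 2 / (k ^ 2 + q ^ 2)) :
    HasStationaryPhase (fun k => r k * kernelTransform q w k)
      ((1 + σ) / 2 * ∫ x in Ioi 0, w x) (65 / 2 * M) (168 * |q| * M) := by
  have hinv := integrable_inv_one_add_sq.integrableOn (s := Ioi 0)
    |>.const_mul (58 * |q| * M)
  have hlorentz := (integrable_sq_div_sq_add_sq q).integrableOn (s := Ioi 0) |>.const_mul (26 * M)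
  have hfree := hw.fastDecay.hasStationaryPhase_cosMultiplier_mul_cos_add_cos_sub_one
    (hw.fastDecay_fluxDeriv (q := 0) (by simp)) hσ
  refine (hfree.perturb (hrmeas.aestronglyMeasurable.mul
    (hw.fastDecay.aestronglyMeasurable_kernelTransform q)) (Integrable.fun_add hinv hlorentz)
    fun k hk => ?_).mono (by linarith) ?_
  · rw [← hw.kernelTransform_zero_eq hk.ne']
    exact hw.abs_mul_kernelTransform_sub_le hq hk.ne' (hr k hk) (hrσ k hk)
  · rw [integral_add hinv hlorentz, integral_const_mul, integral_const_mul,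
      integral_Ioi_inv_one_add_sq, integral_Ioi_sq_div_sq_add_sq, Real.arctan_zero]
    nlinarith [Real.pi_lt_four, mul_nonneg (abs_nonneg q) hw.fastDecay.nonneg]

theorem hasStationaryPhase_dispersive (hw : FastDecayC2 M w) (hq : |q| < 1) :
    HasStationaryPhase (fun k => cosMultiplier (-1) k * kernelTransform q w k) 0
      (65 / 2 * M) (168 * |q| * M) := by
  have hσ : |(-1 : ℝ)| ≤ 1 := by simp
  have h := hw.hasStationaryPhase_mul_kernelTransform hq hσ (by unfold cosMultiplier; fun_prop)
    (fun k _ => abs_cosMultiplier_le hσ k) fun k _ => by rw [sub_self, abs_zero]; positivity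
  simpa only [add_neg_cancel, zero_div, zero_mul] using h

theorem hasStationaryPhase_resonant (hw : FastDecayC2 M w) (hq : |q| < 1) :
    HasStationaryPhase (fun k => resonantMultiplier q k * kernelTransform q w k)
      (∫ x in Ioi 0, w x) (65 / 2 * M) (168 * |q| * M) := by
  have h := hw.hasStationaryPhase_mul_kernelTransform hq (σ := 1) (by simp)
    (by unfold resonantMultiplier; fun_prop) (fun k _ => abs_resonantMultiplier_le hq k)
    fun k hk => abs_resonantMultiplier_sub_le q hk.ne'
  simpa using h

end FastDecayC2

/-- The oscillating solution `(T - ik)², -sech²` times `exp (ik(x + θ))` of the eigenvalue equation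
on the right half line, where `T = tanh(x + θ)`. -/
def jostWave (q k x : ℝ) : Fin 2 → ℂ :=
  Complex.exp (I * k * (x + theta q)) •
    ![(Real.tanh (x + theta q) - I * k) ^ 2, -(sech (x + theta q) : ℂ) ^ 2]

/-- The exponentially decaying solution of the eigenvalue equation on the right half line. -/
def evanescentWave (q k x : ℝ) : Fin 2 → ℂ :=
  Complex.exp (-(mu k * (x + theta q))) •
    ![-(sech (x + theta q) : ℂ) ^ 2, (Real.tanh (x + theta q) + mu k) ^ 2]

/-- The real function to which the even part of `ψ(·, k)` is proportional. -/
def evenProfile (q k x : ℝ) (i : Fin 2) : ℝ :=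
  ((k - I * q) * Complex.exp (-(I * k * theta q)) * jostWave q k x i).re

/-- The complex factor between the even part of `v₊(·, k)` and the real function `evenProfile`. -/
def evenFactor (q k : ℝ) : ℂ :=
  Complex.exp (-(I * k * theta q)) / ((1 + I * k) ^ 2 * (k + I * q))

theorem jostWave_neg (q k x : ℝ) (i : Fin 2) : jostWave q (-k) x i = conj (jostWave q k x i) := by
  fin_cases i <;>
    simp [jostWave, ← Complex.exp_conj, -Complex.ofReal_tanh]

theorem psiRight_eq (q k x : ℝ) (i : Fin 2) :
    psiRight q x k i = coefB q k * jostWave q k x i + coefC q k * conj (jostWave q k x i)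
      + coefD q k * evanescentWave q k x i := by
  rw [← jostWave_neg]
  fin_cases i <;> simp [psiRight, jostWave, evanescentWave] <;> ring

theorem psiLeft_neg_eq (q k x : ℝ) (i : Fin 2) :
    psiLeft q (-x) k i = conj (jostWave q k x i) + coefA q k * evanescentWave q k x i := by
  have hreflect : -x - theta q = -(x + theta q) := by ring
  have hreflect' : ((-x : ℝ) - theta q : ℂ) = -(x + theta q) := by push_cast; ring
  rw [← jostWave_neg, psiLeft, hreflect, hreflect', Real.tanh_neg, sech_neg]
  fin_cases i <;> simp [jostWave, evanescentWave, -Complex.ofReal_tanh] <;> ring_nf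

theorem psiLeft_neg_add_psiRight (q k x : ℝ) (i : Fin 2) :
    psiLeft q (-x) k i + psiRight q x k i
      = (1 + coefC q k) * conj (jostWave q k x i) + coefB q k * jostWave q k x i := by
  have hD : coefD q k = -coefA q k := by
    rw [coefD, coefA]
    ring
  rw [psiLeft_neg_eq, psiRight_eq, hD]
  ring

theorem one_add_coefC {q k : ℝ} (hq : |q| < 1) (hk : k ≠ 0) :
    (1 + coefC q k) * (k - I * q)
      = coefB q k * Complex.exp (2 * I * k * theta q) * (k + I * q) := by
  have hden : (den q k : ℂ) ≠ 0 := by exact_mod_cast (den_pos hq k).ne'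
  have hk' : (k : ℂ) ≠ 0 := by exact_mod_cast hk
  have hmu : (mu k : ℂ) ^ 2 = k ^ 2 + 2 := by exact_mod_cast mu_sq k
  have hden_eq := den_cast q k
  have hexp := Complex.exp_ne_zero (2 * I * k * theta q)
  have hI := Complex.I_sq
  rw [coefB, coefC, Complex.exp_neg]
  field_simp
  rw [hden_eq]
  clear hden hk' hq hk hden_eq hexp
  generalize (mu k : ℂ) = m at *
  grind

theorem ofReal_add_I_mul_ne_zero {x : ℝ} (hx : x ≠ 0) (y : ℝ) : (x + I * y : ℂ) ≠ 0 := fun h =>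
  hx (by simpa using congrArg Complex.re h)

theorem coefB_ne_zero {q k : ℝ} (hq : |q| < 1) (hk : k ≠ 0) : coefB q k ≠ 0 := by
  have hden : (den q k : ℂ) ≠ 0 := by exact_mod_cast (den_pos hq k).ne'
  have hmu : 1 < mu k := by nlinarith [mu_sq k, mu_pos k, sq_nonneg k]
  have hre : k * (q + mu k) ≠ 0 := mul_ne_zero hk (by linarith [(abs_lt.1 hq).1])
  have hexp := Complex.exp_ne_zero (-(2 * I * k * theta q))
  refine div_ne_zero (mul_ne_zero (mul_ne_zero (mul_ne_zero hexp ?_) ?_) ?_)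
    (mul_ne_zero (by exact_mod_cast hk) hden)
  · intro h; apply hk; simpa using congrArg Complex.re h
  · intro h; apply hre; simpa using congrArg Complex.re h
  · intro h; apply hre; simpa using congrArg Complex.re h

theorem psi_neg_add_psi {q k x : ℝ} (hq : |q| < 1) (hk : k ≠ 0) (hx : 0 ≤ x) (i : Fin 2) :
    psi q (-x) k i + psi q x k i
      = 2 * coefB q k * (Complex.exp (I * k * theta q) / (k - I * q)) * evenProfile q k x i := by
  have hleft : psi q (-x) k = psiLeft q (-x) k := by simp [psi, hx]
  have hright : psi q x k = psiRight q x k := by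
    rcases hx.eq_or_lt with rfl | hx
    · simp [psi, psi_continuity hq hk]
    · simp [psi, hx.not_ge]
  have hkq : (k - I * q : ℂ) ≠ 0 := by simpa [sub_eq_add_neg] using ofReal_add_I_mul_ne_zero hk (-q)
  have hC : 1 + coefC q k
      = coefB q k * Complex.exp (I * k * theta q) ^ 2 * (k + I * q) / (k - I * q) := by
    rw [eq_div_iff hkq, one_add_coefC hq hk, ← Complex.exp_nat_mul]
    push_cast
    ring_nf
  rw [hleft, hright, psiLeft_neg_add_psiRight, hC, evenProfile, Complex.re_eq_add_conj]
  have hconj : conj (Complex.exp (-(I * k * theta q))) = Complex.exp (I * k * theta q) := by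
    simp [← Complex.exp_conj]
  simp only [map_mul, map_sub, Complex.conj_ofReal, Complex.conj_I, hconj]
  rw [Complex.exp_neg]
  field_simp
  ring

theorem phase_mul_exp (q k x : ℝ) :
    (k - I * q) * Complex.exp (-(I * k * theta q)) * Complex.exp (I * k * (x + theta q))
      = (k - I * q) * (Real.cos (k * x) + Real.sin (k * x) * I) := by
  rw [mul_assoc, ← Complex.exp_add, Complex.ofReal_cos, Complex.ofReal_sin, ← Complex.exp_mul_I]
  push_cast
  ring_nf

theorem evenProfile_zero (q k x : ℝ) :
    evenProfile q k x 0
      = (q * Real.sin (k * x) + k * Real.cos (k * x)) * (Real.tanh (x + theta q) ^ 2 - k ^ 2)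
        + 2 * k * Real.tanh (x + theta q) * (k * Real.sin (k * x) - q * Real.cos (k * x)) := by
  rw [evenProfile, jostWave, Pi.smul_apply, smul_eq_mul, ← mul_assoc, phase_mul_exp]
  simp only [pow_two, Matrix.cons_val_zero, Complex.mul_re, Complex.mul_im, Complex.sub_re,
    Complex.sub_im, Complex.add_re, Complex.add_im, Complex.ofReal_re, Complex.ofReal_im,
    Complex.I_re, Complex.I_im, zero_mul, mul_zero, one_mul, mul_one, add_zero, zero_add, sub_self,
    sub_zero]
  ring

theorem evenProfile_one (q k x : ℝ) :
    evenProfile q k x 1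
      = -((q * Real.sin (k * x) + k * Real.cos (k * x)) * (1 - Real.tanh (x + theta q) ^ 2)) := by
  have hcast : (-(sech (x + theta q) : ℂ) ^ 2) = ((-sech (x + theta q) ^ 2 : ℝ) : ℂ) := by simp
  rw [evenProfile, jostWave, Pi.smul_apply, smul_eq_mul, ← mul_assoc, phase_mul_exp,
    Matrix.cons_val_one, Matrix.cons_val_fin_one, hcast, Complex.re_mul_ofReal, sech_sq]
  simp only [Complex.mul_re, Complex.sub_re, Complex.sub_im, Complex.mul_im, Complex.add_re,
    Complex.add_im, Complex.ofReal_re, Complex.ofReal_im, Complex.I_re, Complex.I_im, zero_mul,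
    mul_zero, one_mul, mul_one, add_zero, zero_add, sub_self, sub_zero]
  ring

theorem evenProfile_neg (q k x : ℝ) (i : Fin 2) :
    evenProfile q (-k) x i = -evenProfile q k x i := by
  rw [evenProfile, evenProfile, jostWave_neg, ← Complex.conj_re, ← Complex.neg_re]
  congr 1
  simp only [Complex.ofReal_neg, mul_neg, neg_mul, neg_neg, map_mul, map_sub, map_neg,
    Complex.conj_ofReal, Complex.conj_I, Complex.conj_conj, ← Complex.exp_conj]
  ring

theorem evenProfile_zero_sub_one (q : ℝ) {k : ℝ} (hk : k ≠ 0) (x : ℝ) :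
    evenProfile q k x 0 - evenProfile q k x 1 = k * kernel q k x := by
  rw [evenProfile_zero, evenProfile_one, kernel]
  field_simp
  ring

theorem vPlus_add_vPlus_neg {q k x : ℝ} (hq : |q| < 1) (hk : 0 < k) (hx : 0 ≤ x) (i : Fin 2) :
    (vPlus q x k i + vPlus q (-x) k i) / 2 = evenFactor q k * evenProfile q k x i := by
  have hB := coefB_ne_zero hq (neg_ne_zero.2 hk.ne')
  have hone : (1 + I * k : ℂ) ≠ 0 := by simpa using ofReal_add_I_mul_ne_zero one_ne_zero k
  have hsum := psi_neg_add_psi hq (neg_ne_zero.2 hk.ne') hx i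
  rw [evenProfile_neg] at hsum
  have hkq := ofReal_add_I_mul_ne_zero hk.ne' q
  have hkq' : ((-k : ℝ) - I * q : ℂ) = -(k + I * q) := by push_cast; ring
  simp only [vPlus, hk, if_true, Pi.smul_apply, smul_eq_mul, neg_neg]
  rw [← mul_add, hsum, evenFactor, hkq']
  push_cast
  field_simp

theorem aEven_eq {q k x : ℝ} (hq : |q| < 1) (hk : 0 < k) (hx : 0 ≤ x) :
    aEven q x k = evenFactor q k * evenProfile q k x 0 :=
  vPlus_add_vPlus_neg hq hk hx 0

theorem bEven_eq {q k x : ℝ} (hq : |q| < 1) (hk : 0 < k) (hx : 0 ≤ x) :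
    bEven q x k = evenFactor q k * evenProfile q k x 1 :=
  vPlus_add_vPlus_neg hq hk hx 1

theorem a_zero_eq {q k : ℝ} (hq : |q| < 1) (hk : 0 < k) :
    a q 0 k = -(evenFactor q k * k * (k ^ 2 + q ^ 2)) := by
  have heven : aEven q 0 k = a q 0 k := by simp [aEven]
  rw [← heven, aEven_eq hq hk le_rfl, evenProfile_zero, zero_add, tanh_theta hq]
  simp only [mul_zero, Real.sin_zero, Real.cos_zero, mul_one, zero_add, zero_sub]
  push_cast
  ring

theorem b_zero_eq {q k : ℝ} (hq : |q| < 1) (hk : 0 < k) :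
    b q 0 k = -(evenFactor q k * k * (1 - q ^ 2)) := by
  have heven : bEven q 0 k = b q 0 k := by simp [bEven]
  rw [← heven, bEven_eq hq hk le_rfl, evenProfile_one, zero_add, tanh_theta hq]
  simp [mul_assoc]

theorem evenFactor_mul_conj (q k : ℝ) :
    evenFactor q k * conj (evenFactor q k) = ((((1 + k ^ 2) ^ 2 * (k ^ 2 + q ^ 2))⁻¹ : ℝ) : ℂ) := by
  have hexp : ‖Complex.exp (-(I * k * theta q))‖ = 1 := by simp [Complex.norm_exp]
  have hnorm (x y : ℝ) : ‖(x + I * y : ℂ)‖ ^ 2 = x ^ 2 + y ^ 2 := by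
    rw [← Complex.normSq_eq_norm_sq, mul_comm, Complex.normSq_add_mul_I]
  have hone : ‖(1 + I * k : ℂ)‖ ^ 2 = 1 + k ^ 2 := by simpa using hnorm 1 k
  rw [Complex.mul_conj, Complex.normSq_eq_norm_sq, evenFactor, norm_div, norm_mul, norm_pow, hexp,
    div_pow, one_pow, one_div, mul_pow, hone, hnorm]

theorem transformIntegrand_eq {q k x : ℝ} (hq : |q| < 1) (hk : 0 < k) (w : ℝ → ℝ) (hx : 0 ≤ x) :
    transformIntegrand q w k x = conj (evenFactor q k) * k * (kernel q k x * w x : ℝ) := by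
  have hkernel : (evenProfile q k x 0 - evenProfile q k x 1 : ℂ) = k * kernel q k x := by
    exact_mod_cast evenProfile_zero_sub_one q hk.ne' x
  rw [transformIntegrand, aEven_eq hq hk hx, bEven_eq hq hk hx]
  simp only [map_mul, Complex.conj_ofReal, Complex.ofReal_mul]
  linear_combination conj (evenFactor q k) * w x * hkernel

theorem transform_eq {q k : ℝ} (hq : |q| < 1) (hk : 0 < k) (w : ℝ → ℝ) :
    transform q w k
      = 2 / √(2 * Real.pi) * (conj (evenFactor q k) * k * kernelTransform q w k) := by
  rw [transform, kernelTransform, ← integral_complex_ofReal, ← integral_const_mul (_ * _)]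
  congr 1
  exact setIntegral_congr_fun measurableSet_Ioi fun x hx =>
    transformIntegrand_eq hq hk w (mem_Ioi.1 hx).le

theorem waveIntegrand_eq {q k : ℝ} (hq : |q| < 1) (hk : 0 < k) (w : ℝ → ℝ) (t : ℝ) :
    waveIntegrand q w t k = -(2 / √(2 * Real.pi))
      * (Complex.exp (-(I * t / 2)) * (Complex.exp (-(I * t / 2) * k ^ 2)
          * (cosMultiplier (-1) k * kernelTransform q w k : ℝ))
        + Complex.exp (I * t / 2) * (Complex.exp (-(-(I * t / 2)) * k ^ 2)
          * (resonantMultiplier q k * kernelTransform q w k : ℝ))) := by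
  have hdispersive : cosMultiplier (-1) k
      = k ^ 2 * (k ^ 2 + q ^ 2) * ((1 + k ^ 2) ^ 2 * (k ^ 2 + q ^ 2))⁻¹ := by
    rw [cosMultiplier]
    field_simp
    ring
  have hresonant : resonantMultiplier q k
      = k ^ 2 * (1 - q ^ 2) * ((1 + k ^ 2) ^ 2 * (k ^ 2 + q ^ 2))⁻¹ := by
    rw [resonantMultiplier]
    ring
  have hphase : Complex.exp (-(1 / 2 * I * t * (1 + k ^ 2)))
      = Complex.exp (-(I * t / 2)) * Complex.exp (-(I * t / 2) * k ^ 2) := by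
    rw [← Complex.exp_add]
    ring_nf
  have hphase' : Complex.exp (1 / 2 * I * t * (1 + k ^ 2))
      = Complex.exp (I * t / 2) * Complex.exp (-(-(I * t / 2)) * k ^ 2) := by
    rw [← Complex.exp_add]
    ring_nf
  rw [waveIntegrand, a_zero_eq hq hk, b_zero_eq hq hk, transform_eq hq hk, hphase, hphase',
    hdispersive, hresonant]
  simp only [Complex.ofReal_mul, ← evenFactor_mul_conj]
  push_cast
  ring

theorem abs_kernel_le (q k : ℝ) {x : ℝ} (hx : 0 < x) :
    |kernel q k x| ≤ 4 * (1 + |q|) * (1 + k ^ 2) * (1 + x ^ 2) := by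
  have hk := sq_nonneg k
  have hone : |1 - k ^ 2| ≤ 1 + k ^ 2 := abs_le.2 ⟨by linarith, by linarith⟩
  have htanh := (Real.abs_tanh_lt_one (x + theta q)).le
  have hsin : |q * (1 - k ^ 2) + 2 * k ^ 2 * Real.tanh (x + theta q)|
      ≤ 2 * (1 + |q|) * (1 + k ^ 2) := by
    refine (abs_add_le _ _).trans ?_
    rw [abs_mul, abs_mul, abs_of_nonneg (by positivity : 0 ≤ 2 * k ^ 2)]
    nlinarith [abs_nonneg q]
  have hcos : |1 - k ^ 2 - 2 * q * Real.tanh (x + theta q)| ≤ 2 * (1 + |q|) * (1 + k ^ 2) := by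
    refine (abs_sub _ _).trans ?_
    rw [abs_mul, abs_mul, abs_two]
    nlinarith [abs_nonneg q, mul_nonneg (abs_nonneg q) hk]
  calc |kernel q k x|
      ≤ 2 * (1 + |q|) * (1 + k ^ 2) * x + 2 * (1 + |q|) * (1 + k ^ 2) * 1 := by
        refine (abs_add_le _ _).trans (add_le_add ?_ ?_)
        · rw [abs_mul]
          exact mul_le_mul hsin (abs_sin_mul_div_le k hx) (abs_nonneg _) (by positivity)
        · rw [abs_mul]
          exact mul_le_mul hcos (Real.abs_cos_le_one _) (abs_nonneg _) (by positivity)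
    _ = 2 * (1 + |q|) * (1 + k ^ 2) * (x + 1) := by ring
    _ ≤ 2 * (1 + |q|) * (1 + k ^ 2) * (2 * (1 + x ^ 2)) := by
        gcongr
        nlinarith [sq_nonneg (x - 1)]
    _ = 4 * (1 + |q|) * (1 + k ^ 2) * (1 + x ^ 2) := by ring

theorem FastDecay.integrableOn_kernel_mul {M : ℝ} {w : ℝ → ℝ} (hw : FastDecay M w) (q k : ℝ) :
    IntegrableOn (fun x => kernel q k x * w x) (Ioi 0) :=
  hw.integrableOn_mul (by unfold kernel; fun_prop) fun _ hx => abs_kernel_le q k hx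

theorem FastDecay.integrableOn_transformIntegrand {M q k : ℝ} {w : ℝ → ℝ} (hw : FastDecay M w)
    (hq : |q| < 1) (hk : 0 < k) : IntegrableOn (transformIntegrand q w k) (Ioi 0) :=
  IntegrableOn.congr_fun
    ((hw.integrableOn_kernel_mul q k).ofReal.const_mul (conj (evenFactor q k) * k))
    (fun _ hx => (transformIntegrand_eq hq hk w (mem_Ioi.1 hx).le).symm) measurableSet_Ioi

theorem cpow_pi_div_neg_I_mul {t : ℝ} (ht : 0 < t) :
    (Real.pi / -(I * t / 2) : ℂ) ^ (1 / 2 : ℂ)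
      = √(2 * Real.pi / t) * Complex.exp (I * Real.pi / 4) := by
  have hpos : 0 < 2 * Real.pi / t := by positivity
  have hrotate : (Real.pi / -(I * t / 2) : ℂ) = ((2 * Real.pi / t : ℝ) : ℂ) * I := by
    have : (t : ℂ) ≠ 0 := by exact_mod_cast ht.ne'
    push_cast
    field_simp
    linear_combination -Complex.I_sq
  have hne := mul_ne_zero (Complex.ofReal_ne_zero.2 hpos.ne') Complex.I_ne_zero
  rw [hrotate, Complex.cpow_def_of_ne_zero hne,
    Complex.log_ofReal_mul hpos Complex.I_ne_zero, Complex.log_I, add_mul, Complex.exp_add,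
    Real.sqrt_eq_rpow, Real.rpow_def_of_pos hpos]
  push_cast
  ring_nf

theorem sqrt_two_div_pi_mul : √(2 / Real.pi) * (2 / √(2 * Real.pi)) = 2 / Real.pi := by
  rw [mul_div_left_comm, ← Real.sqrt_div (by positivity),
    show 2 / Real.pi / (2 * Real.pi) = (1 / Real.pi) ^ 2 by field_simp,
    Real.sqrt_sq (by positivity)]
  ring

theorem two_div_sqrt_two_mul_pi_mul {t : ℝ} (ht : 0 < t) :
    2 / √(2 * Real.pi * t) = 2 / Real.pi * (√(2 * Real.pi / t) / 2) := by
  rw [show 2 * Real.pi / t = (2 * Real.pi) ^ 2 / (2 * Real.pi * t) by field_simp,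
    Real.sqrt_div (by positivity), Real.sqrt_sq (by positivity)]
  field_simp

theorem div_half_rpow_le {c t : ℝ} (hc : 0 ≤ c) (ht : 0 < t) :
    c / (t / 2) ^ (3 / 2 : ℝ) ≤ 4 * c / t ^ (3 / 2 : ℝ) := by
  have htwo : (2 : ℝ) ^ (3 / 2 : ℝ) ≤ 4 :=
    (Real.rpow_le_rpow_of_exponent_le one_le_two (by norm_num : (3 / 2 : ℝ) ≤ (2 : ℕ))).trans_eq
      (by rw [Real.rpow_natCast]; norm_num)
  rw [Real.div_rpow ht.le zero_le_two, div_div_eq_mul_div, mul_comm c]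
  gcongr

theorem norm_two_div_pi_mul_add_le (t : ℝ) (z z' : ℂ) :
    ‖-(2 / Real.pi) * (Complex.exp (-(I * t / 2)) * z + Complex.exp (I * t / 2) * z')‖
      ≤ ‖z‖ + ‖z'‖ := by
  have hexp : ‖Complex.exp (I * t / 2)‖ = 1 := by simp [Complex.norm_exp]
  have hexp' : ‖Complex.exp (-(I * t / 2))‖ = 1 := by simp [Complex.norm_exp]
  have hpi : ‖-(2 / Real.pi : ℂ)‖ ≤ 1 := by
    rw [norm_neg, norm_div, Complex.norm_real, Real.norm_of_nonneg Real.pi_pos.le,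
      div_le_one Real.pi_pos]
    simpa using Real.two_le_pi
  rw [norm_mul]
  refine (mul_le_of_le_one_left (norm_nonneg _) hpi).trans ((norm_add_le _ _).trans_eq ?_)
  rw [norm_mul, norm_mul, hexp, hexp', one_mul, one_mul]

namespace FastDecayC2

variable {M q t : ℝ} {w : ℝ → ℝ}

theorem integrableOn_waveIntegrand (hw : FastDecayC2 M w) (hq : |q| < 1) (t : ℝ) :
    IntegrableOn (waveIntegrand q w t) (Ioi 0) := by
  have hdispersive := integrableOn_cexp_neg_mul_sq_mul (b := I * t / 2)
    (hw.hasStationaryPhase_dispersive hq).integrableOn (by simp)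
  have hresonant := integrableOn_cexp_neg_mul_sq_mul (b := -(I * t / 2))
    (hw.hasStationaryPhase_resonant hq).integrableOn (by simp)
  exact IntegrableOn.congr_fun (((hdispersive.const_mul _).add (hresonant.const_mul _)).const_mul _)
    (fun k hk => (waveIntegrand_eq hq (mem_Ioi.1 hk) w t).symm) measurableSet_Ioi

theorem wZero_eq (hw : FastDecayC2 M w) (hq : |q| < 1) (t : ℝ) :
    wZero q w t = -(2 / Real.pi)
      * (Complex.exp (-(I * t / 2))
          * gaussianIntegral (fun k => cosMultiplier (-1) k * kernelTransform q w k) (I * t / 2)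
        + Complex.exp (I * t / 2)
          * gaussianIntegral (fun k => resonantMultiplier q k * kernelTransform q w k)
            (-(I * t / 2))) := by
  have hdispersive := integrableOn_cexp_neg_mul_sq_mul (b := I * t / 2)
    (hw.hasStationaryPhase_dispersive hq).integrableOn (by simp)
  have hresonant := integrableOn_cexp_neg_mul_sq_mul (b := -(I * t / 2))
    (hw.hasStationaryPhase_resonant hq).integrableOn (by simp)
  have hconst : (√(2 / Real.pi) * -(2 / √(2 * Real.pi)) : ℂ) = -(2 / Real.pi) := by
    rw [mul_neg]
    exact_mod_cast congrArg (fun z : ℝ => -(z : ℂ)) sqrt_two_div_pi_mul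
  rw [wZero, setIntegral_congr_fun measurableSet_Ioi
    fun k hk => waveIntegrand_eq hq (mem_Ioi.1 hk) w t, integral_const_mul, ← mul_assoc, hconst,
    integral_add (hdispersive.const_mul _) (hresonant.const_mul _), integral_const_mul,
    integral_const_mul]
  rfl

theorem norm_wZero_add_le (hw : FastDecayC2 M w) (hq : |q| < 1) (ht : 0 < t) :
    ‖wZero q w t + 2 / √(2 * Real.pi * t) * Complex.exp (I * t / 2 + I * Real.pi / 4)
        * (∫ x in Ioi 0, w x : ℝ)‖
      ≤ 336 * M * (1 / t ^ (3 / 2 : ℝ) + |q|) := by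
  have hI : (I * t / 2 : ℂ) ≠ 0 := by simp [ht.ne']
  have hdispersive := (hw.hasStationaryPhase_dispersive hq).norm_sub_le (I * t / 2) (by simp) hI
  have hresonant := (hw.hasStationaryPhase_resonant hq).norm_sub_le (-(I * t / 2)) (by simp)
    (neg_ne_zero.2 hI)
  have hnorm : ‖(I * t / 2 : ℂ)‖ = t / 2 := by simp [abs_of_pos ht]
  have hconst : (2 / √(2 * Real.pi * t) : ℂ) = 2 / Real.pi * (√(2 * Real.pi / t) / 2) := by
    exact_mod_cast congrArg (fun x : ℝ => (x : ℂ)) (two_div_sqrt_two_mul_pi_mul ht)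
  rw [norm_neg, cpow_pi_div_neg_I_mul ht] at hresonant
  rw [hnorm] at hdispersive hresonant
  rw [Complex.ofReal_zero, mul_zero, sub_zero] at hdispersive
  rw [hw.wZero_eq hq, hconst, Complex.exp_add]
  have hM := hw.fastDecay.nonneg
  have hremainder := div_half_rpow_le (by positivity : 0 ≤ 65 / 2 * M) ht
  refine (congrArg norm (by ring)).trans_le ((norm_two_div_pi_mul_add_le t _ _).trans
    ((add_le_add hdispersive hresonant).trans ?_))
  calc _ ≤ 2 * (4 * (65 / 2 * M) / t ^ (3 / 2 : ℝ) + 168 * |q| * M) := by linarith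
    _ = 260 * M * (1 / t ^ (3 / 2 : ℝ)) + 336 * M * |q| := by ring
    _ ≤ 336 * M * (1 / t ^ (3 / 2 : ℝ)) + 336 * M * |q| := by gcongr; norm_num
    _ = 336 * M * (1 / t ^ (3 / 2 : ℝ) + |q|) := by ring

end FastDecayC2

/-- The decay constant of the data extracted from the weighted sup norm bounds `C k l`; the
summand `1` makes it positive. -/
def decayConst (C : ℕ → ℕ → ℝ) : ℝ :=
  1 + ∑ l ∈ Finset.range 3, (|C 0 l| + 2 * |C 2 l| + |C 4 l|)

theorem decayConst_pos (C : ℕ → ℕ → ℝ) : 0 < decayConst C := by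
  unfold decayConst
  positivity

namespace Admissible

variable {C : ℕ → ℕ → ℝ} {q : ℝ} {w : ℝ → ℝ}

theorem differentiableAt_iteratedDeriv (h : Admissible C q w) (l : ℕ) {x : ℝ} (hx : 0 < x) :
    DifferentiableAt ℝ (iteratedDeriv l w) x :=
  ((h.smooth.differentiableOn_iteratedDerivWithin (m := l)
    (by exact_mod_cast WithTop.coe_lt_top l) (uniqueDiffOn_Ioi 0)).congr
      fun _ hy => (iteratedDerivWithin_of_isOpen isOpen_Ioi hy).symm).differentiableAt
    (Ioi_mem_nhds hx)

theorem fastDecay_iteratedDeriv (h : Admissible C q w) {l : ℕ} (hl : l < 3) :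
    FastDecay (decayConst C * |q|) (iteratedDeriv l w) where
  aestronglyMeasurable :=
    ContinuousOn.aestronglyMeasurable
      (fun _ hx => (h.differentiableAt_iteratedDeriv l hx).continuousAt.continuousWithinAt)
      measurableSet_Ioi
  abs_le_mul_inv_sq x hx := by
    have hconst : |C 0 l| + 2 * |C 2 l| + |C 4 l| ≤ decayConst C := by
      have := Finset.single_le_sum (f := fun l => |C 0 l| + 2 * |C 2 l| + |C 4 l|)
        (fun _ _ => by positivity) (Finset.mem_range.2 hl)
      rw [decayConst]
      linarith
    have hbound (k : ℕ) : x ^ k * |iteratedDeriv l w x| ≤ |C k l| * |q| := by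
      rw [← abs_of_pos (pow_pos hx k), ← abs_mul]
      exact (h.bound k l x hx).trans (by gcongr; exact le_abs_self _)
    rw [← div_eq_mul_inv, le_div_iff₀ (by positivity)]
    calc |iteratedDeriv l w x| * (1 + x ^ 2) ^ 2
        = x ^ 0 * |iteratedDeriv l w x| + 2 * (x ^ 2 * |iteratedDeriv l w x|)
          + x ^ 4 * |iteratedDeriv l w x| := by ring
      _ ≤ |C 0 l| * |q| + 2 * (|C 2 l| * |q|) + |C 4 l| * |q| := by
        linarith [hbound 0, hbound 2, hbound 4]
      _ = (|C 0 l| + 2 * |C 2 l| + |C 4 l|) * |q| := by ring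
      _ ≤ decayConst C * |q| := by gcongr

theorem fastDecayC2 (h : Admissible C q w) : FastDecayC2 (decayConst C * |q|) w where
  fastDecay := by simpa using h.fastDecay_iteratedDeriv (l := 0) (by norm_num)
  fastDecay_deriv := by simpa using h.fastDecay_iteratedDeriv (l := 1) (by norm_num)
  fastDecay_deriv_deriv := by
    simpa [iteratedDeriv_succ] using h.fastDecay_iteratedDeriv (l := 2) (by norm_num)
  differentiableAt x hx := by simpa using h.differentiableAt_iteratedDeriv 0 hx
  differentiableAt_deriv x hx := by simpa using h.differentiableAt_iteratedDeriv 1 hx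

end Admissible

end DeltaNLS

end

theorem mainTheorem6_general {q M : ℝ} {w₀ : ℝ → ℝ} (hq : |q| < 1)
    (heven : ∀ x, w₀ (-x) = w₀ x) (hw : DeltaNLS.FastDecayC2 M w₀) :
    Integrable w₀ ∧
    (∀ k : ℝ, 0 < k → IntegrableOn (DeltaNLS.transformIntegrand q w₀ k) (Ioi 0)) ∧
    ∀ t : ℝ, 0 < t →
      IntegrableOn (DeltaNLS.waveIntegrand q w₀ t) (Ioi 0) ∧
      ‖DeltaNLS.wZero q w₀ t
          - -((1 / √(2 * Real.pi * t) : ℝ)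
            * Complex.exp (Complex.I * t / 2 + Complex.I * Real.pi / 4)
            * ((∫ x, w₀ x : ℝ) : ℂ))‖
        ≤ 336 * M * (1 / t ^ (3 / 2 : ℝ) + |q|) := by
  have hcomp_abs : (fun x => w₀ |x|) = w₀ := funext fun x => by
    rcases abs_choice x with h | h <;> rw [h]
    exact heven x
  have hintegral : ∫ x, w₀ x = 2 * ∫ x in Ioi 0, w₀ x := by
    rw [← integral_comp_abs, hcomp_abs]
  refine ⟨hcomp_abs ▸ DeltaNLS.integrable_comp_abs hw.fastDecay.integrableOn,
    fun k hk => hw.fastDecay.integrableOn_transformIntegrand hq hk,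
    fun t ht => ⟨hw.integrableOn_waveIntegrand hq t, ?_⟩⟩
  convert hw.norm_wZero_add_le hq ht using 2
  rw [hintegral]
  push_cast
  ring

theorem mainTheorem6 :
    ∃ q₀ : ℝ, 0 < q₀ ∧ q₀ < 1 ∧
      ∀ C : ℕ → ℕ → ℝ, ∃ K : ℝ, 0 < K ∧
        ∀ q : ℝ, 0 < |q| → |q| < q₀ →
          ∀ w₀ : ℝ → ℝ, DeltaNLS.Admissible C q w₀ →
            Integrable w₀ ∧
            (∀ k : ℝ, 0 < k →
              IntegrableOn (DeltaNLS.transformIntegrand q w₀ k) (Ioi 0)) ∧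
            ∀ t : ℝ, 1 ≤ t →
              IntegrableOn (DeltaNLS.waveIntegrand q w₀ t) (Ioi 0) ∧
              ‖DeltaNLS.wZero q w₀ t
                  - -((1 / √(2 * Real.pi * t) : ℝ)
                    * Complex.exp (Complex.I * t / 2 + Complex.I * Real.pi / 4)
                    * ((∫ x, w₀ x : ℝ) : ℂ))‖
                ≤ K * (|q| / t ^ (3 / 2 : ℝ) + q ^ 2) := by
  refine ⟨1 / 2, by norm_num, by norm_num, fun C => ⟨336 * DeltaNLS.decayConst C,
    mul_pos (by norm_num) (DeltaNLS.decayConst_pos C), fun q _ hq w₀ hw => ?_⟩⟩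
  obtain ⟨hint, htransform, hwave⟩ :=
    mainTheorem6_general (hq.trans (by norm_num)) hw.even hw.fastDecayC2
  refine ⟨hint, htransform, fun t ht => (hwave t (by linarith)).imp_right fun h => h.trans_eq ?_⟩
  rw [← sq_abs q]
  ring
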